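/- A weight function is a continuous increasing (i.e. non-decreasing) function $\omega:[0,\infty)\to[0,\infty)$ such that: $(\alpha)$ there is $K\ge 1$ with $\omega(2x)\le K(1+\omega(x))$ for all $x\ge 0$; $(\beta)$ $\omega(x)=o(x)$ as $x\to\infty$; $(\gamma)$ there are $a\in\mathbb{R}$, $b>0$ with $\omega(x)\ge a+b\log(1+x)$ for all $x\ge 0$; $(\delta)$ $t\mapsto\omega(e^t)$ is convex on $\mathbb{R}$. For weight functions $\omega_1,\dots,\omega_d,\sigma_1,\dots,\sigma_d$ put $\Omega(x)=\sum_j\omega_j(|x_j|)$ and $\Sigma(x)=\sum_j\sigma_j(|x_j|)$, $x\in\mathbb{R}^d$. With $\hat f(\xi)=\int_{\mathbb{R}^d}e^{-ix\cdot\xi}f(x)\,dx$, let $\mathcal{S}^{\Sigma}_{\Omega}(\mathbb{R}^d)$ be the space of all $f\in L^1(\mathbb{R}^d)$ with $f,\hat f\in C^\infty(\mathbb{R}^d)$ and $$\|\exp(\lambda\Omega)D^\alpha f\|_\infty<\infty,\qquad \|\exp(\lambda\Sigma)D^\alpha\hat f\|_\infty<\infty\qquad\text{for all }\lambda>0,\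 \alpha\in\mathbb{N}_0^d,$$ with the topology given by the seminorms $\|\exp(n\Omega)D^\alpha f\|_\infty$ and $\|\exp(n\Sigma)D^\alpha\hat f\|_\infty$ ($n\in\mathbb{N}_0$, $\alpha\in\mathbb{N}_0^d$), and let $(\mathcal{S}^{\Sigma}_{\Omega})'(\mathbb{R}^d)$ be the space of continuous linear functionals on it. Every $f\in\mathcal{S}^{\Sigma}_{\Omega}(\mathbb{R}^d)$ is regarded as the element $\varphi\mapsto\int f\varphi$ of $(\mathcal{S}^{\Sigma}_{\Omega})'(\mathbb{R}^d)$. Let $\omega_{i,j},\sigma_{i,j}$ ($i=1,2$, $j=1,\dots,N$) be weight functions and define on $\mathbb{R}^{2N}=\mathbb{R}^N\times\mathbb{R}^N$ $$\Omega(x,y)=\sum_{j}\omega_{1,j}(|x_j|)+\sum_j\omega_{2,j}(|y_j|),\qquad \Sigma(x,y)=\sum_{j}\sigma_{1,j}(|x_j|)+\sum_j\sigma_{2,j}(|y_j|),$$ $$\Omega_1(x,y)=\sum_{j}\omega_{1,j}(|x_j|)+\sum_j\sigma_{2,j}(|y_j|),\qquad \Sigma_1(x,y)=\sum_{j}\sigma_{1,j}(|x_j|)+\sum_j\omega_{2,j}(|y_j|).$$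 Let $\mathcal{F}_1F(y,\xi)=\int_{\mathbb{R}^N}e^{-ix\cdot y}F(x,\xi)\,dx$ and $\mathcal{F}_2F(x,\eta)=\int_{\mathbb{R}^N}e^{-i\xi\cdot\eta}F(x,\xi)\,d\xi$. Then: (1) $\mathcal{F}_2$ is a continuous linear map $\mathcal{S}^{\Sigma}_{\Omega}(\mathbb{R}^{2N})\to\mathcal{S}^{\Sigma_1}_{\Omega_1}(\mathbb{R}^{2N})$; (2) $\mathcal{F}_1$ is a continuous linear map $\mathcal{S}^{\Sigma}_{\Omega}(\mathbb{R}^{2N})\to\mathcal{S}^{\Omega_1}_{\Sigma_1}(\mathbb{R}^{2N})$; (3) for every $\varphi\in\mathcal{S}^{\Sigma_1}_{\Omega_1}(\mathbb{R}^{2N})$ one has $\mathcal{F}_2\varphi\in\mathcal{S}^{\Sigma}_{\Omega}(\mathbb{R}^{2N})$, and $(\mathcal{F}_2u)(\varphi):=u(\mathcal{F}_2\varphi)$ defines a linear map $\mathcal{F}_2:(\mathcal{S}^{\Sigma}_{\Omega})'(\mathbb{R}^{2N})\to(\mathcal{S}^{\Sigma_1}_{\Omega_1})'(\mathbb{R}^{2N})$,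 which extends the map in (1) and is continuous both for the strong topologies and for the weak-$*$ topologies of the duals; (4) for every $\varphi\in\mathcal{S}^{\Omega_1}_{\Sigma_1}(\mathbb{R}^{2N})$ one has $\mathcal{F}_1\varphi\in\mathcal{S}^{\Sigma}_{\Omega}(\mathbb{R}^{2N})$, and $(\mathcal{F}_1u)(\varphi):=u(\mathcal{F}_1\varphi)$ defines a linear map $\mathcal{F}_1:(\mathcal{S}^{\Sigma}_{\Omega})'(\mathbb{R}^{2N})\to(\mathcal{S}^{\Omega_1}_{\Sigma_1})'(\mathbb{R}^{2N})$, which extends the map in (2) and is continuous both for the strong topologies and for the weak-$*$ topologies of the duals. -/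

import Mathlib

open scoped NNReal

noncomputable section

namespace UltraDiff

/-- A weight function on `[0, ∞)` (possibly quasianalytic, not necessarily subadditive). -/
structure WeightFunction where
  /-- the underlying function `[0, ∞) → [0, ∞)` -/
  toFun : ℝ≥0 → ℝ≥0
  continuous' : Continuous toFun
  monotone' : Monotone toFun
  alpha : ∃ K : ℝ, 1 ≤ K ∧ ∀ x : ℝ≥0, (toFun (2 * x) : ℝ) ≤ K * (1 + (toFun x : ℝ))
  beta : (fun x : ℝ≥0 => (toFun x : ℝ)) =o[Filter.atTop] (fun x : ℝ≥0 => (x : ℝ))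
  gamma : ∃ a b : ℝ, 0 < b ∧ ∀ x : ℝ≥0, a + b * Real.log (1 + (x : ℝ)) ≤ (toFun x : ℝ)
  delta : ConvexOn ℝ Set.univ (fun t : ℝ => (toFun (Real.toNNReal (Real.exp t)) : ℝ))

section Space

variable {ι : Type} [Fintype ι]

/-- The direct sum `⊕ ω_j`, that is, `x ↦ ∑ j, ω_j(|x_j|)`. -/
def directSum (ω : ι → WeightFunction) (x : EuclideanSpace ℝ ι) : ℝ :=
  ∑ j, ((ω j).toFun ‖x j‖₊ : ℝ)

/-- The Fourier transform `f ↦ ∫ exp(-i x ξ) f(x) dx`. -/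
def fourierT (f : EuclideanSpace ℝ ι → ℂ) (ξ : EuclideanSpace ℝ ι) : ℂ :=
  ∫ x : EuclideanSpace ℝ ι, Complex.exp (-(Complex.I * ((inner ℝ x ξ : ℝ) : ℂ))) * f x

open Classical in
/-- The operator `D_j = -i ∂_j`. -/
def dPartial (j : ι) (f : EuclideanSpace ℝ ι → ℂ) : EuclideanSpace ℝ ι → ℂ :=
  fun x => -Complex.I * fderiv ℝ f x (EuclideanSpace.single j 1)

/-- The composition of the powers `D_j ^ (α j)`, for `j` along the list `l`. -/
def dList (α : ι → ℕ) (l : List ι) (f : EuclideanSpace ℝ ι → ℂ) : EuclideanSpace ℝ ι → ℂ :=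
  l.foldr (fun j g => (dPartial j)^[α j] g) f

/-- The operator `D^α = ∏ j, D_j ^ (α j)` for a multi-index `α`. It is applied to smooth functions
only, for which the order of the differentiations is irrelevant. -/
def dMulti (α : ι → ℕ) (f : EuclideanSpace ℝ ι → ℂ) : EuclideanSpace ℝ ι → ℂ :=
  dList α Finset.univ.toList f

lemma dPartial_smooth (j : ι) {f : EuclideanSpace ℝ ι → ℂ} (hf : ContDiff ℝ (⊤ : ℕ∞) f) :
    ContDiff ℝ (⊤ : ℕ∞) (dPartial j f) := by
  unfold dPartial
  exact contDiff_const.mul ((hf.fderiv_right (m := ((⊤ : ℕ∞) : WithTop ℕ∞)) (by simp)).clm_apply contDiff_const)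

lemma dPartial_add (j : ι) {f g : EuclideanSpace ℝ ι → ℂ} (hf : ContDiff ℝ (⊤ : ℕ∞) f)
    (hg : ContDiff ℝ (⊤ : ℕ∞) g) : dPartial j (f + g) = dPartial j f + dPartial j g := by
  funext x
  have h1 := (hf.differentiable (by simp)) x
  have h2 := (hg.differentiable (by simp)) x
  simp only [dPartial, Pi.add_apply]
  rw [fderiv_add h1 h2, add_apply]
  ring

lemma dPartial_smul (j : ι) (c : ℂ) {f : EuclideanSpace ℝ ι → ℂ} (hf : ContDiff ℝ (⊤ : ℕ∞) f) :
    dPartial j (c • f) = c • dPartial j f := by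
  funext x
  have h1 := (hf.differentiable (by simp)) x
  simp only [dPartial, Pi.smul_apply]
  rw [fderiv_const_smul h1, smul_apply]
  simp only [smul_eq_mul]
  ring

lemma dPartial_iterate (j : ι) (n : ℕ) :
    (∀ f : EuclideanSpace ℝ ι → ℂ, ContDiff ℝ (⊤ : ℕ∞) f → ContDiff ℝ (⊤ : ℕ∞) ((dPartial j)^[n] f)) ∧
    (∀ f g : EuclideanSpace ℝ ι → ℂ, ContDiff ℝ (⊤ : ℕ∞) f → ContDiff ℝ (⊤ : ℕ∞) g →
      (dPartial j)^[n] (f + g) = (dPartial j)^[n] f + (dPartial j)^[n] g) ∧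
    (∀ (c : ℂ) (f : EuclideanSpace ℝ ι → ℂ), ContDiff ℝ (⊤ : ℕ∞) f →
      (dPartial j)^[n] (c • f) = c • (dPartial j)^[n] f) := by
  induction n with
  | zero => simp
  | succ n ih =>
    obtain ⟨h1, h2, h3⟩ := ih
    refine ⟨fun f hf => ?_, fun f g hf hg => ?_, fun c f hf => ?_⟩
    · rw [Function.iterate_succ_apply']; exact dPartial_smooth j (h1 f hf)
    · simp only [Function.iterate_succ_apply']
      rw [h2 f g hf hg, dPartial_add j (h1 f hf) (h1 g hg)]
    · simp only [Function.iterate_succ_apply']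
      rw [h3 c f hf, dPartial_smul j c (h1 f hf)]

lemma dList_props (α : ι → ℕ) (l : List ι) :
    (∀ f : EuclideanSpace ℝ ι → ℂ, ContDiff ℝ (⊤ : ℕ∞) f → ContDiff ℝ (⊤ : ℕ∞) (dList α l f)) ∧
    (∀ f g : EuclideanSpace ℝ ι → ℂ, ContDiff ℝ (⊤ : ℕ∞) f → ContDiff ℝ (⊤ : ℕ∞) g →
      dList α l (f + g) = dList α l f + dList α l g) ∧
    (∀ (c : ℂ) (f : EuclideanSpace ℝ ι → ℂ), ContDiff ℝ (⊤ : ℕ∞) f →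
      dList α l (c • f) = c • dList α l f) := by
  induction l with
  | nil => simp [dList]
  | cons j l ih =>
    obtain ⟨h1, h2, h3⟩ := ih
    obtain ⟨k1, k2, k3⟩ := dPartial_iterate (ι := ι) j (α j)
    refine ⟨fun f hf => ?_, fun f g hf hg => ?_, fun c f hf => ?_⟩
    · exact k1 _ (h1 f hf)
    · have e : ∀ h : EuclideanSpace ℝ ι → ℂ,
        dList α (j :: l) h = (dPartial j)^[α j] (dList α l h) := fun _ => rfl
      rw [e, e, e, h2 f g hf hg, k2 _ _ (h1 f hf) (h1 g hg)]
    · have e : ∀ h : EuclideanSpace ℝ ι → ℂ,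
        dList α (j :: l) h = (dPartial j)^[α j] (dList α l h) := fun _ => rfl
      rw [e, e, h3 c f hf, k3 _ _ (h1 f hf)]

lemma dMulti_add (α : ι → ℕ) {f g : EuclideanSpace ℝ ι → ℂ} (hf : ContDiff ℝ (⊤ : ℕ∞) f)
    (hg : ContDiff ℝ (⊤ : ℕ∞) g) : dMulti α (f + g) = dMulti α f + dMulti α g :=
  (dList_props α _).2.1 f g hf hg

lemma dMulti_smul (α : ι → ℕ) (c : ℂ) {f : EuclideanSpace ℝ ι → ℂ} (hf : ContDiff ℝ (⊤ : ℕ∞) f) :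
    dMulti α (c • f) = c • dMulti α f :=
  (dList_props α _).2.2 c f hf

lemma dMulti_zero_index (f : EuclideanSpace ℝ ι → ℂ) : dMulti 0 f = f := by
  unfold dMulti
  induction (Finset.univ.toList : List ι) with
  | nil => rfl
  | cons j l ih => exact ih

lemma exp_fourier_integrable {f : EuclideanSpace ℝ ι → ℂ} (hf : MeasureTheory.Integrable f)
    (ξ : EuclideanSpace ℝ ι) : MeasureTheory.Integrable
      (fun x => Complex.exp (-(Complex.I * ((inner ℝ x ξ : ℝ) : ℂ))) * f x) := by
  refine hf.bdd_mul (c := 1) (Continuous.aestronglyMeasurable (by fun_prop)) ?_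
  refine Filter.Eventually.of_forall fun x => ?_
  rw [Complex.norm_exp]
  simp

lemma fourierT_add {f g : EuclideanSpace ℝ ι → ℂ} (hf : MeasureTheory.Integrable f)
    (hg : MeasureTheory.Integrable g) : fourierT (f + g) = fourierT f + fourierT g := by
  funext ξ
  simp only [fourierT, Pi.add_apply, mul_add]
  exact MeasureTheory.integral_add (exp_fourier_integrable hf ξ) (exp_fourier_integrable hg ξ)

lemma fourierT_smul (c : ℂ) (f : EuclideanSpace ℝ ι → ℂ) :
    fourierT (c • f) = c • fourierT f := by
  funext ξ
  simp only [fourierT, Pi.smul_apply, smul_eq_mul, ← MeasureTheory.integral_const_mul]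
  congr 1
  funext x
  ring

/-- `f` is smooth and `‖exp(r Ω) D^α f‖_∞ < ∞` for all `r > 0` and all multi-indices `α`,
where `Ω` is the direct sum of the weights `ω`. -/
def WeightedDecay (ω : ι → WeightFunction) (f : EuclideanSpace ℝ ι → ℂ) : Prop :=
  ContDiff ℝ (⊤ : ℕ∞) f ∧ ∀ r : ℝ, 0 < r → ∀ α : ι → ℕ,
    ∃ C : ℝ, ∀ x, Real.exp (r * directSum ω x) * ‖dMulti α f x‖ ≤ C

/-- The quantity `‖exp(n Ω) D^α f‖_∞`. -/
def weightedSup (ω : ι → WeightFunction) (n : ℕ) (α : ι → ℕ) (f : EuclideanSpace ℝ ι → ℂ) : ℝ :=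
  ⨆ x, Real.exp (n * directSum ω x) * ‖dMulti α f x‖

lemma directSum_nonneg (ω : ι → WeightFunction) (x : EuclideanSpace ℝ ι) : 0 ≤ directSum ω x :=
  Finset.sum_nonneg fun _ _ => NNReal.coe_nonneg _

lemma WeightedDecay.add {ω : ι → WeightFunction} {f g : EuclideanSpace ℝ ι → ℂ}
    (hf : WeightedDecay ω f) (hg : WeightedDecay ω g) : WeightedDecay ω (f + g) := by
  refine ⟨hf.1.add hg.1, fun r hr α => ?_⟩
  obtain ⟨C, hC⟩ := hf.2 r hr α
  obtain ⟨C', hC'⟩ := hg.2 r hr α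
  refine ⟨C + C', fun x => ?_⟩
  rw [dMulti_add α hf.1 hg.1, Pi.add_apply]
  calc _ ≤ Real.exp (r * directSum ω x) * (‖dMulti α f x‖ + ‖dMulti α g x‖) := by
        gcongr; exact norm_add_le _ _
    _ ≤ C + C' := by rw [mul_add]; exact add_le_add (hC x) (hC' x)

lemma dMulti_zero (α : ι → ℕ) : dMulti α (0 : EuclideanSpace ℝ ι → ℂ) = 0 := by
  have h := dMulti_smul α (0 : ℂ) (f := (0 : EuclideanSpace ℝ ι → ℂ)) contDiff_const
  simpa using h

lemma WeightedDecay.zero (ω : ι → WeightFunction) :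
    WeightedDecay ω (0 : EuclideanSpace ℝ ι → ℂ) := by
  refine ⟨contDiff_const, fun r _ α => ⟨0, fun x => ?_⟩⟩
  rw [dMulti_zero]
  simp

lemma WeightedDecay.smul {ω : ι → WeightFunction} (c : ℂ) {f : EuclideanSpace ℝ ι → ℂ}
    (hf : WeightedDecay ω f) : WeightedDecay ω (c • f) := by
  refine ⟨hf.1.const_smul c, fun r hr α => ?_⟩
  obtain ⟨C, hC⟩ := hf.2 r hr α
  refine ⟨‖c‖ * C, fun x => ?_⟩
  rw [dMulti_smul α c hf.1, Pi.smul_apply, norm_smul, mul_left_comm]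
  exact mul_le_mul_of_nonneg_left (hC x) (norm_nonneg c)

lemma WeightedDecay.bddAbove {ω : ι → WeightFunction} {f : EuclideanSpace ℝ ι → ℂ}
    (hf : WeightedDecay ω f) (n : ℕ) (α : ι → ℕ) :
    BddAbove (Set.range fun x => Real.exp (n * directSum ω x) * ‖dMulti α f x‖) := by
  obtain ⟨C, hC⟩ := hf.2 (n + 1) (by positivity) α
  refine ⟨C, ?_⟩
  rintro _ ⟨x, rfl⟩
  refine le_trans ?_ (hC x)
  have := directSum_nonneg ω x
  simp only
  gcongr
  linarith

lemma weightedSup_add {ω : ι → WeightFunction} {f g : EuclideanSpace ℝ ι → ℂ}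
    (hf : WeightedDecay ω f) (hg : WeightedDecay ω g) (n : ℕ) (α : ι → ℕ) :
    weightedSup ω n α (f + g) ≤ weightedSup ω n α f + weightedSup ω n α g := by
  refine ciSup_le fun x => ?_
  rw [dMulti_add α hf.1 hg.1, Pi.add_apply]
  calc _ ≤ Real.exp (n * directSum ω x) * (‖dMulti α f x‖ + ‖dMulti α g x‖) := by
        gcongr; exact norm_add_le _ _
    _ ≤ _ := by
        rw [mul_add]
        exact add_le_add (le_ciSup (hf.bddAbove n α) x) (le_ciSup (hg.bddAbove n α) x)

lemma weightedSup_smul {ω : ι → WeightFunction} (c : ℂ) {f : EuclideanSpace ℝ ι → ℂ}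
    (hf : WeightedDecay ω f) (n : ℕ) (α : ι → ℕ) :
    weightedSup ω n α (c • f) = ‖c‖ * weightedSup ω n α f := by
  unfold weightedSup
  rw [Real.mul_iSup_of_nonneg (norm_nonneg c)]
  congr 1
  funext x
  rw [dMulti_smul α c hf.1, Pi.smul_apply, norm_smul, mul_left_comm]

/-- The functions `f ∈ L¹` such that `f` and `f̂` are smooth, all derivatives of `f` decay with
respect to the direct sum of `ω`, and all derivatives of `f̂` with respect to that of `σ`. -/
def swoSubmodule (ω σ : ι → WeightFunction) : Submodule ℂ (EuclideanSpace ℝ ι → ℂ) where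
  carrier := {f | MeasureTheory.Integrable f ∧ WeightedDecay ω f ∧ WeightedDecay σ (fourierT f)}
  add_mem' := by
    rintro f g ⟨h1, h2, h3⟩ ⟨k1, k2, k3⟩
    refine ⟨h1.add k1, h2.add k2, ?_⟩
    rw [fourierT_add h1 k1]
    exact h3.add k3
  zero_mem' := by
    refine ⟨MeasureTheory.integrable_zero _ _ _, WeightedDecay.zero ω, ?_⟩
    have h : fourierT (0 : EuclideanSpace ℝ ι → ℂ) = 0 := by
      simpa using fourierT_smul (0 : ℂ) (0 : EuclideanSpace ℝ ι → ℂ)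
    rw [h]
    exact WeightedDecay.zero σ
  smul_mem' := by
    rintro c f ⟨h1, h2, h3⟩
    refine ⟨h1.smul c, h2.smul c, ?_⟩
    rw [fourierT_smul]
    exact h3.smul c

/-- The space `𝒮_Ω^Σ` with `Ω = ⊕ ω_j` (decay of `f`) and `Σ = ⊕ σ_j` (decay of `f̂`). It is a
type copy of the submodule above, which carries the Fréchet topology instead of the topology of
pointwise convergence. -/
def Swo (ω σ : ι → WeightFunction) : Type := ↥(swoSubmodule ω σ)

variable (ω σ : ι → WeightFunction)

instance : AddCommGroup (Swo ω σ) := inferInstanceAs (AddCommGroup ↥(swoSubmodule ω σ))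

instance : Module ℂ (Swo ω σ) := inferInstanceAs (Module ℂ ↥(swoSubmodule ω σ))

instance : CoeFun (Swo ω σ) (fun _ => EuclideanSpace ℝ ι → ℂ) := ⟨fun f => f.1⟩

/-- The seminorms `‖exp(n Ω) D^α f‖_∞` and `‖exp(n Σ) D^α f̂‖_∞`. -/
def swoSeminorm : SeminormFamily ℂ (Swo ω σ) ((ℕ × (ι → ℕ)) ⊕ (ℕ × (ι → ℕ)))
  | Sum.inl p => Seminorm.of (fun f => weightedSup ω p.1 p.2 f.1)
      (fun f g => weightedSup_add f.2.2.1 g.2.2.1 p.1 p.2)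
      (fun c f => weightedSup_smul c f.2.2.1 p.1 p.2)
  | Sum.inr p => Seminorm.of (fun f => weightedSup σ p.1 p.2 (fourierT f.1))
      (fun f g => by
        have h : (f + g).1 = f.1 + g.1 := rfl
        rw [h, fourierT_add f.2.1 g.2.1]
        exact weightedSup_add f.2.2.2 g.2.2.2 p.1 p.2)
      (fun c f => by
        have h : (c • f).1 = c • f.1 := rfl
        rw [h, fourierT_smul]
        exact weightedSup_smul c f.2.2.2 p.1 p.2)

instance : TopologicalSpace (Swo ω σ) := (swoSeminorm ω σ).moduleFilterBasis.topology

lemma swo_withSeminorms : WithSeminorms (swoSeminorm ω σ) := ⟨rfl⟩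

instance : IsTopologicalAddGroup (Swo ω σ) :=
  (swoSeminorm ω σ).addGroupFilterBasis.isTopologicalAddGroup

instance : ContinuousSMul ℂ (Swo ω σ) := (swoSeminorm ω σ).moduleFilterBasis.continuousSMul

variable {ω σ}

lemma swo_norm_le (φ : Swo ω σ) (x : EuclideanSpace ℝ ι) :
    ‖φ x‖ ≤ swoSeminorm ω σ (Sum.inl (0, 0)) φ := by
  have h := le_ciSup (φ.2.2.1.bddAbove 0 0) x
  simp only [Nat.cast_zero, zero_mul, Real.exp_zero, one_mul, dMulti_zero_index] at h
  refine h.trans (le_of_eq ?_)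
  show _ = weightedSup ω 0 0 φ.1
  simp [weightedSup, dMulti_zero_index]

lemma swo_mul_integrable (f φ : Swo ω σ) : MeasureTheory.Integrable (fun x => f x * φ x) := by
  refine f.2.1.mul_bdd (c := swoSeminorm ω σ (Sum.inl (0, 0)) φ) ?_ ?_
  · exact φ.2.2.1.1.continuous.aestronglyMeasurable
  · exact Filter.Eventually.of_forall (swo_norm_le φ)

/-- The ultradistribution `φ ↦ ∫ f φ` given by a function `f`. -/
def regularDist (f : Swo ω σ) : StrongDual ℂ (Swo ω σ) where
  toFun φ := ∫ x, f x * φ x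
  map_add' φ ψ := by
    rw [← MeasureTheory.integral_add (swo_mul_integrable f φ) (swo_mul_integrable f ψ)]
    congr 1
    funext x
    exact mul_add _ _ _
  map_smul' c φ := by
    rw [RingHom.id_apply, smul_eq_mul, ← MeasureTheory.integral_const_mul]
    congr 1
    funext x
    exact mul_left_comm _ _ _
  cont := by
    let L : Swo ω σ →ₗ[ℂ] ℂ :=
      { toFun := fun φ => ∫ x, f x * φ x
        map_add' := fun φ ψ => by
          rw [← MeasureTheory.integral_add (swo_mul_integrable f φ) (swo_mul_integrable f ψ)]
          congr 1
          funext x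
          exact mul_add _ _ _
        map_smul' := fun c φ => by
          rw [RingHom.id_apply, smul_eq_mul, ← MeasureTheory.integral_const_mul]
          congr 1
          funext x
          exact mul_left_comm _ _ _ }
    show Continuous L
    refine WithSeminorms.continuous_normedSpace_rng ℂ (swo_withSeminorms ω σ) L ?_
    refine ⟨{Sum.inl (0, 0)}, ⟨∫ x, ‖f x‖, MeasureTheory.integral_nonneg fun _ => norm_nonneg _⟩,
      fun φ => ?_⟩
    simp only [Finset.sup_singleton]
    show ‖∫ x, f x * φ x‖ ≤ (∫ x, ‖f x‖) * swoSeminorm ω σ (Sum.inl (0, 0)) φ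
    rw [← MeasureTheory.integral_mul_const]
    refine MeasureTheory.norm_integral_le_of_norm_le (f.2.1.norm.mul_const _) ?_
    refine Filter.Eventually.of_forall fun x => ?_
    rw [norm_mul]
    exact mul_le_mul_of_nonneg_left (swo_norm_le φ x) (norm_nonneg _)

end Space

section PartialFourier

variable {N : ℕ}

/-- `ℝ^{2N}`, whose coordinates are indexed by two blocks of `N` indices. -/
abbrev R2 (N : ℕ) : Type := EuclideanSpace ℝ (Fin N ⊕ Fin N)

/-- The point `(x, y)` of `ℝ^{2N}`. -/
def pair (x y : EuclideanSpace ℝ (Fin N)) : R2 N :=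
  WithLp.toLp 2 (Sum.elim (fun j => x j) (fun j => y j))

/-- The first block of variables. -/
def fstBlock (z : R2 N) : EuclideanSpace ℝ (Fin N) := WithLp.toLp 2 (fun j => z (Sum.inl j))

/-- The second block of variables. -/
def sndBlock (z : R2 N) : EuclideanSpace ℝ (Fin N) := WithLp.toLp 2 (fun j => z (Sum.inr j))

/-- The partial Fourier transform in the first block,
`(y, ξ) ↦ ∫ exp(-i x y) F(x, ξ) dx`. -/
def partialFourier₁ (F : R2 N → ℂ) (z : R2 N) : ℂ :=
  ∫ x : EuclideanSpace ℝ (Fin N),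
    Complex.exp (-(Complex.I * ((inner ℝ x (fstBlock z) : ℝ) : ℂ))) * F (pair x (sndBlock z))

/-- The partial Fourier transform in the second block,
`(x, η) ↦ ∫ exp(-i ξ η) F(x, ξ) dξ`. -/
def partialFourier₂ (F : R2 N → ℂ) (z : R2 N) : ℂ :=
  ∫ ξ : EuclideanSpace ℝ (Fin N),
    Complex.exp (-(Complex.I * ((inner ℝ ξ (sndBlock z) : ℝ) : ℂ))) * F (pair (fstBlock z) ξ)

/-- The weights of `ω` in the first block and those of `σ` in the second block. -/
def mixWeights (ω σ : Fin N ⊕ Fin N → WeightFunction) : Fin N ⊕ Fin N → WeightFunction :=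
  Sum.elim (fun j => ω (Sum.inl j)) (fun j => σ (Sum.inr j))

end PartialFourier

end UltraDiff

end

open UltraDiff

/-! The core is an estimate for `partialFourier₂ f` at a point (x, η). Integrating |f(x, ·)| shows
that any multiple of the ω-weight in x is absorbed. On the other hand the full transform is the
first partial transform of the second one, so Fourier inversion in the first block bounds the value
at (x, η) by (2π)^{-N} ∫ |f̂(x', η)| dx' (`norm_partialFourier₂_le`), which absorbs any multiple of
the σ-weight in η. Multiplying the two bounds and taking a square root yields decay in both blocks
at once (`tame_partialFourier₂`).

Derivatives cost nothing: D_j of the partial transform is the partial transform of D_j f or of -y_j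
f, and both operations map the space continuously into itself. Decay of the Fourier transform
reduces to the same estimate, because `fourierT` commutes with `partialFourier₂` and maps the space
to the one with ω and σ exchanged.

The first partial transform is the second one conjugated by the swap of blocks. Mixing weights is an
involution, so the same maps also act in the opposite direction. The maps on the duals are
precompositions with these, and they extend the original ones by Fubini and the multiplication
formula ∫ f ĝ = ∫ f̂ g. -/

open UltraDiff MeasureTheory
namespace UltraDiff

/-! ### Iterated derivatives as words. -/

section Words

variable {ι : Type} [Fintype ι]

/-- The composition of the operators `D_j` along a word; the first letter acts first. -/
noncomputable def dWord : List ι → (EuclideanSpace ℝ ι → ℂ) → EuclideanSpace ℝ ι → ℂ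
  | [], f => f
  | j :: l, f => dWord l (dPartial j f)

lemma dWord_append (l m : List ι) (f : EuclideanSpace ℝ ι → ℂ) :
    dWord (l ++ m) f = dWord m (dWord l f) := by
  induction l generalizing f with
  | nil => rfl
  | cons j l ih => exact ih _

lemma dWord_replicate (n : ℕ) (j : ι) (f : EuclideanSpace ℝ ι → ℂ) :
    dWord (List.replicate n j) f = (dPartial j)^[n] f := by
  induction n generalizing f with
  | zero => rfl
  | succ n ih => exact ih _

lemma dWord_add (l : List ι) {f g : EuclideanSpace ℝ ι → ℂ} (hf : ContDiff ℝ (⊤ : ℕ∞) f)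
    (hg : ContDiff ℝ (⊤ : ℕ∞) g) : dWord l (f + g) = dWord l f + dWord l g := by
  induction l generalizing f g with
  | nil => rfl
  | cons j l ih =>
    simp only [dWord]
    rw [dPartial_add j hf hg, ih (dPartial_smooth j hf) (dPartial_smooth j hg)]

lemma dWord_smul (l : List ι) (c : ℂ) {f : EuclideanSpace ℝ ι → ℂ}
    (hf : ContDiff ℝ (⊤ : ℕ∞) f) : dWord l (c • f) = c • dWord l f := by
  induction l generalizing f with
  | nil => rfl
  | cons j l ih =>
    simp only [dWord]
    rw [dPartial_smul j c hf, ih (dPartial_smooth j hf)]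

-- Symmetry of the second derivative of a smooth function.
open Classical in
lemma dPartial_comm (i j : ι) {f : EuclideanSpace ℝ ι → ℂ} (hf : ContDiff ℝ (⊤ : ℕ∞) f) :
    dPartial i (dPartial j f) = dPartial j (dPartial i f) := by
  have hd : Differentiable ℝ (fderiv ℝ f) :=
    (hf.fderiv_right (m := ((⊤ : ℕ∞) : WithTop ℕ∞)) (by simp)).differentiable (by simp)
  have key : ∀ i j : ι, ∀ x, dPartial i (dPartial j f) x =
      -(fderiv ℝ (fderiv ℝ f) x (EuclideanSpace.single i 1) (EuclideanSpace.single j 1)) := by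
    intro i j x
    have h1 : HasFDerivAt (dPartial j f) ((-Complex.I) •
        ((fderiv ℝ (fderiv ℝ f) x).flip (EuclideanSpace.single j 1))) x := by
      have := ((hd x).hasFDerivAt.clm_apply
        (hasFDerivAt_const (EuclideanSpace.single j (1 : ℝ)) x)).const_mul (-Complex.I)
      convert! this using 1
      ext v
      simp
    rw [dPartial, h1.fderiv]
    simp only [smul_apply, ContinuousLinearMap.flip_apply, smul_eq_mul]
    linear_combination (fderiv ℝ (fderiv ℝ f) x (EuclideanSpace.single i 1)
      (EuclideanSpace.single j 1)) * Complex.I_mul_I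
  funext x
  rw [key, key]
  have hs : IsSymmSndFDerivAt ℝ f x :=
    (hf.contDiffAt).isSymmSndFDerivAt (by simpa using WithTop.coe_le_coe.2 (le_top : (2 : ℕ∞) ≤ ⊤))
  rw [hs.eq]

lemma dWord_perm {l m : List ι} (h : l.Perm m) {f : EuclideanSpace ℝ ι → ℂ}
    (hf : ContDiff ℝ (⊤ : ℕ∞) f) : dWord l f = dWord m f := by
  induction h generalizing f with
  | nil => rfl
  | cons j _ ih => exact ih (dPartial_smooth j hf)
  | swap i j l => simp only [dWord]; rw [dPartial_comm _ _ hf]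
  | trans _ _ ih₁ ih₂ => exact (ih₁ hf).trans (ih₂ hf)

/-- The word of the operator `dList α l`. -/
def listWord (α : ι → ℕ) : List ι → List ι
  | [] => []
  | j :: l => listWord α l ++ List.replicate (α j) j

lemma dList_eq_dWord (α : ι → ℕ) (l : List ι) (f : EuclideanSpace ℝ ι → ℂ) :
    dList α l f = dWord (listWord α l) f := by
  induction l with
  | nil => rfl
  | cons j l ih => rw [listWord, dWord_append, dWord_replicate, ← ih]; rfl

lemma dMulti_eq_dWord (α : ι → ℕ) (f : EuclideanSpace ℝ ι → ℂ) :
    dMulti α f = dWord (listWord α Finset.univ.toList) f := dList_eq_dWord α _ f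

lemma count_listWord [DecidableEq ι] (α : ι → ℕ) (i : ι) (l : List ι) (hl : l.Nodup) :
    (listWord α l).count i = if i ∈ l then α i else 0 := by
  induction l with
  | nil => simp [listWord]
  | cons j l ih =>
    rw [List.nodup_cons] at hl
    rw [listWord, List.count_append, ih hl.2, List.count_replicate]
    by_cases hij : j = i
    · subst hij
      simp [hl.1]
    · simp [hij, Ne.symm hij]

-- Links the two descriptions of derivatives: inductions peel letters off a word, while the
-- seminorms of the space are indexed by multi-indices. Only the letter counts matter, as the D_j
-- commute.
open Classical in
lemma dWord_eq_dMulti (l : List ι) {f : EuclideanSpace ℝ ι → ℂ}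
    (hf : ContDiff ℝ (⊤ : ℕ∞) f) : dWord l f = dMulti (fun i => l.count i) f := by
  rw [dMulti_eq_dWord]
  refine dWord_perm (List.perm_iff_count.2 fun i => ?_) hf
  rw [count_listWord _ _ _ (Finset.nodup_toList _)]
  simp

end Words

/-! ### Families with weighted bounds, and continuity of operators. -/

section Tame

variable {ι : Type} [Fintype ι] {V W : Type*} [AddCommGroup V] [Module ℂ V] [TopologicalSpace V]
  [AddCommGroup W] [Module ℂ W] [TopologicalSpace W]

/-- A family of smooth functions whose weighted suprema are dominated by continuous seminorms
of the parameter. -/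
def Tame (ω : ι → WeightFunction) (T : V → EuclideanSpace ℝ ι → ℂ) : Prop :=
  (∀ v, ContDiff ℝ (⊤ : ℕ∞) (T v)) ∧ ∀ (n : ℕ) (l : List ι), ∃ q : Seminorm ℂ V, Continuous q ∧
    ∀ v x, Real.exp (n * directSum ω x) * ‖dWord l (T v) x‖ ≤ q v

variable {ω σ ω' σ' : ι → WeightFunction} {T : V → EuclideanSpace ℝ ι → ℂ}

lemma continuous_nnreal_smul {q : Seminorm ℂ V} (hq : Continuous q) (c : ℝ≥0) :
    Continuous (c • q : Seminorm ℂ V) := by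
  have : (⇑(c • q : Seminorm ℂ V)) = fun v => (c : ℝ) * q v := rfl
  rw [this]
  exact continuous_const.mul hq

lemma continuous_seminorm_add {p q : Seminorm ℂ V} (hp : Continuous p) (hq : Continuous q) :
    Continuous (p + q : Seminorm ℂ V) := by
  have : (⇑(p + q : Seminorm ℂ V)) = fun v => p v + q v := rfl
  rw [this]
  exact hp.add hq

lemma Tame.weightedDecay (h : Tame ω T) (v : V) : WeightedDecay ω (T v) := by
  refine ⟨h.1 v, fun r _ α => ?_⟩
  obtain ⟨n, hn⟩ := exists_nat_ge r
  obtain ⟨q, -, hq⟩ := h.2 n (listWord α Finset.univ.toList)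
  refine ⟨q v, fun x => le_trans ?_ (hq v x)⟩
  rw [dMulti_eq_dWord]
  have := directSum_nonneg ω x
  gcongr

lemma Tame.comp (h : Tame ω T) (S : W →L[ℂ] V) : Tame ω (fun w => T (S w)) := by
  refine ⟨fun w => h.1 _, fun n l => ?_⟩
  obtain ⟨q, hq, hb⟩ := h.2 n l
  exact ⟨q.comp S.toLinearMap, hq.comp S.continuous, fun w x => hb _ x⟩

lemma Tame.const_smul (h : Tame ω T) (c : ℂ) : Tame ω (fun v => c • T v) := by
  refine ⟨fun v => (h.1 v).const_smul c, fun n l => ?_⟩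
  obtain ⟨q, hq, hb⟩ := h.2 n l
  refine ⟨‖c‖₊ • q, continuous_nnreal_smul hq _, fun v x => ?_⟩
  rw [dWord_smul l c (h.1 v), Pi.smul_apply, norm_smul, mul_left_comm]
  exact mul_le_mul_of_nonneg_left (hb v x) (norm_nonneg c)

/-- Because the first letter acts first, the bound for the word `j :: l` is by definition the bound
for `l` on the derivative. -/
lemma Tame.dPartial (h : Tame ω T) (j : ι) : Tame ω (fun v => dPartial j (T v)) :=
  ⟨fun v => dPartial_smooth j (h.1 v), fun n l => h.2 n (j :: l)⟩

lemma tame_swo (ω σ : ι → WeightFunction) : Tame ω (fun f : Swo ω σ => f.1) := by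
  classical
  refine ⟨fun f => f.2.2.1.1, fun n l => ?_⟩
  refine ⟨swoSeminorm ω σ (Sum.inl (n, fun i => l.count i)),
    (swo_withSeminorms ω σ).continuous_seminorm _, fun f x => ?_⟩
  have := le_ciSup (f.2.2.1.bddAbove n fun i => l.count i) x
  rw [dWord_eq_dMulti l f.2.2.1.1]
  convert! this using 5

lemma tame_swo_fourier (ω σ : ι → WeightFunction) :
    Tame σ (fun f : Swo ω σ => fourierT f.1) := by
  classical
  refine ⟨fun f => f.2.2.2.1, fun n l => ?_⟩
  refine ⟨swoSeminorm ω σ (Sum.inr (n, fun i => l.count i)),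
    (swo_withSeminorms ω σ).continuous_seminorm _, fun f x => ?_⟩
  have := le_ciSup (f.2.2.2.bddAbove n fun i => l.count i) x
  rw [dWord_eq_dMulti l f.2.2.2.1]
  convert! this using 5

/-- The device that builds the operators between these spaces: continuity is tested against the
defining seminorms, and each is dominated by a continuous seminorm on the source. -/
lemma exists_continuousLinearMap [IsTopologicalAddGroup V] [ContinuousSMul ℂ V]
    (hadd : ∀ v w, T (v + w) = T v + T w)
    (hsmul : ∀ (c : ℂ) v, T (c • v) = c • T v) (hi : ∀ v, Integrable (T v))
    (h₁ : Tame ω' T) (h₂ : Tame σ' (fun v => fourierT (T v))) :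
    ∃ S : V →L[ℂ] Swo ω' σ', ∀ v, (S v).1 = T v := by
  let S : V →ₗ[ℂ] Swo ω' σ' :=
    { toFun := fun v => ⟨T v, hi v, h₁.weightedDecay v, h₂.weightedDecay v⟩
      map_add' := fun v w => Subtype.ext (hadd v w)
      map_smul' := fun c v => Subtype.ext (hsmul c v) }
  have hS : Continuous S := by
    refine (swo_withSeminorms ω' σ').continuous_of_continuous_comp S fun i => ?_
    rcases i with ⟨n, α⟩ | ⟨n, α⟩
    · obtain ⟨q, hq, hb⟩ := h₁.2 n (listWord α Finset.univ.toList)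
      refine Seminorm.continuous_of_le hq fun v => ?_
      refine ciSup_le fun x => ?_
      rw [dMulti_eq_dWord]
      exact hb v x
    · obtain ⟨q, hq, hb⟩ := h₂.2 n (listWord α Finset.univ.toList)
      refine Seminorm.continuous_of_le hq fun v => ?_
      refine ciSup_le fun x => ?_
      rw [dMulti_eq_dWord]
      exact hb v x
  exact ⟨⟨S, hS⟩, fun v => rfl⟩

end Tame

/-! ### Polynomial growth and integrability from condition (γ). -/

section Weights

variable {ι : Type} [Fintype ι]

/-- With k ≥ m/b, condition (γ) gives m log(1+t) ≤ k b log(1+t) ≤ k (w(t) - a); exponentiate. -/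
lemma WeightFunction.exists_pow_le (w : WeightFunction) (m : ℕ) :
    ∃ k : ℕ, ∃ C : ℝ, 0 ≤ C ∧ ∀ t : ℝ≥0, (1 + (t : ℝ)) ^ m ≤ C * Real.exp (k * (w.toFun t : ℝ)) := by
  obtain ⟨a, b, hb, h⟩ := w.gamma
  obtain ⟨k, hk⟩ := exists_nat_ge ((m : ℝ) / b)
  rw [div_le_iff₀ hb] at hk
  refine ⟨k, Real.exp (-(k * a)), (Real.exp_pos _).le, fun t => ?_⟩
  have ht : (0 : ℝ) < 1 + t := by positivity
  have hlog : 0 ≤ Real.log (1 + (t : ℝ)) := Real.log_nonneg (by simp)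
  rw [← Real.exp_add]
  calc (1 + (t : ℝ)) ^ m = Real.exp (m * Real.log (1 + t)) := by
        rw [← Real.log_pow, Real.exp_log (by positivity)]
    _ ≤ _ := by
        refine Real.exp_le_exp.2 ?_
        have h1 := mul_le_mul_of_nonneg_left (h t) (Nat.cast_nonneg (α := ℝ) k)
        have h2 := mul_le_mul_of_nonneg_right hk hlog
        nlinarith

/-- The ℓ¹ norm dominates the Euclidean one, and 1 + ∑ |x_j| consists of some of the terms of the
expanded product. The product form lets each weight act on its own coordinate. -/
lemma one_add_norm_le_prod (x : EuclideanSpace ℝ ι) : 1 + ‖x‖ ≤ ∏ j, (1 + ‖x j‖) := by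
  have h1 : ‖x‖ ≤ ∑ j, ‖x j‖ := by
    classical
    conv_lhs => rw [← (EuclideanSpace.basisFun ι ℝ).sum_repr x]
    refine (norm_sum_le _ _).trans (le_of_eq ?_)
    refine Finset.sum_congr rfl fun j _ => ?_
    simp [norm_smul]
  have h2 : ∀ s : Finset ι, 1 + ∑ j ∈ s, ‖x j‖ ≤ ∏ j ∈ s, (1 + ‖x j‖) := by
    classical
    intro s
    induction s using Finset.induction_on with
    | empty => simp
    | insert j s hj ih =>
      rw [Finset.sum_insert hj, Finset.prod_insert hj]
      have : 0 ≤ ∑ j ∈ s, ‖x j‖ := Finset.sum_nonneg fun _ _ => norm_nonneg _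
      nlinarith [norm_nonneg (x j)]
  exact (add_le_add_right h1 1).trans (h2 Finset.univ)

lemma exists_one_add_norm_pow_le (ω : ι → WeightFunction) (m : ℕ) :
    ∃ k : ℕ, ∃ C : ℝ, 0 ≤ C ∧ ∀ x, (1 + ‖x‖) ^ m ≤ C * Real.exp (k * directSum ω x) := by
  choose k C hC h using fun j => (ω j).exists_pow_le m
  -- The exponents k_j differ from weight to weight; their sum is a common upper bound.
  refine ⟨∑ j, k j, ∏ j, C j, Finset.prod_nonneg fun j _ => hC j, fun x => ?_⟩
  calc (1 + ‖x‖) ^ m ≤ (∏ j, (1 + ‖x j‖)) ^ m := by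
        gcongr
        exact one_add_norm_le_prod x
    _ = ∏ j, (1 + ‖x j‖) ^ m := (Finset.prod_pow _ _ _).symm
    _ ≤ ∏ j, C j * Real.exp ((∑ i, k i : ℕ) * ((ω j).toFun ‖x j‖₊ : ℝ)) := by
        refine Finset.prod_le_prod (fun j _ => by positivity) fun j _ => ?_
        refine (h j ‖x j‖₊).trans ?_
        have : k j ≤ ∑ i, k i := Finset.single_le_sum (fun _ _ => Nat.zero_le _) (Finset.mem_univ j)
        have hc := hC j
        gcongr
    _ = _ := by
        rw [Finset.prod_mul_distrib, ← Real.exp_sum, ← Finset.mul_sum]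
        rfl

lemma continuous_directSum (ω : ι → WeightFunction) : Continuous (directSum ω) := by
  unfold directSum
  refine continuous_finsetSum _ fun j _ => ?_
  exact NNReal.continuous_coe.comp ((ω j).continuous'.comp (by fun_prop))

lemma exists_integrable_exp_neg (ω : ι → WeightFunction) :
    ∃ k : ℕ, Integrable (fun x : EuclideanSpace ℝ ι => Real.exp (-(k * directSum ω x))) := by
  -- One more than the dimension makes (1 + ‖x‖)^(-m) integrable.
  set m := Module.finrank ℝ (EuclideanSpace ℝ ι) + 1 with hm
  obtain ⟨k, C, hC, h⟩ := exists_one_add_norm_pow_le ω m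
  have hi : Integrable (fun x : EuclideanSpace ℝ ι => C * (1 + ‖x‖) ^ (-(m : ℝ))) :=
    (integrable_one_add_norm (by simp [hm])).const_mul C
  refine ⟨k, hi.mono' ?_ (Filter.Eventually.of_forall fun x => ?_)⟩
  · exact (Real.continuous_exp.comp
      (continuous_const.mul (continuous_directSum ω)).neg).aestronglyMeasurable
  · have hx : 0 < (1 + ‖x‖) ^ m := by positivity
    rw [Real.norm_eq_abs, Real.abs_exp, Real.exp_neg, Real.rpow_neg (by positivity),
      Real.rpow_natCast, ← div_eq_mul_inv, le_div_iff₀ hx, inv_mul_le_iff₀ (Real.exp_pos _),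
      mul_comm]
    exact h x

/-- Used to spend the surplus s of a weighted bound on an integrable factor while keeping the weight
r. -/
lemma le_mul_exp_neg {r s a C : ℝ} (h : Real.exp (r + s) * a ≤ C) :
    Real.exp r * a ≤ C * Real.exp (-s) := by
  rw [Real.exp_neg, ← div_eq_mul_inv, le_div_iff₀ (Real.exp_pos _)]
  rw [Real.exp_add] at h
  linarith

end Weights

/-! ### Integrability and multiplication by coordinates. -/

section Tame

variable {ι : Type} [Fintype ι] {V : Type*} [AddCommGroup V] [Module ℂ V] [TopologicalSpace V]
  {ω : ι → WeightFunction} {T : V → EuclideanSpace ℝ ι → ℂ}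

lemma Tame.integrable (h : Tame ω T) (v : V) : Integrable (T v) := by
  obtain ⟨k, hk⟩ := exists_integrable_exp_neg ω
  obtain ⟨q, -, hq⟩ := h.2 k []
  refine (hk.const_mul (q v)).mono' (h.1 v).continuous.aestronglyMeasurable
    (Filter.Eventually.of_forall fun x => ?_)
  have h1 : Real.exp (0 + k * directSum ω x) * ‖T v x‖ ≤ q v := by
    rw [zero_add]
    exact hq v x
  simpa using le_mul_exp_neg h1

open Classical in
lemma dPartial_coord_mul (i j : ι) {f : EuclideanSpace ℝ ι → ℂ}
    (hf : ContDiff ℝ (⊤ : ℕ∞) f) : dPartial i (fun x => (x j : ℂ) * f x) =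
      (fun x => (x j : ℂ) * dPartial i f x) + (if i = j then -Complex.I else 0) • f := by
  funext x
  have h1 : HasFDerivAt (fun x : EuclideanSpace ℝ ι => (x j : ℂ))
      (Complex.ofRealCLM.comp (EuclideanSpace.proj j)) x :=
    (Complex.ofRealCLM.comp (EuclideanSpace.proj j : EuclideanSpace ℝ ι →L[ℝ] ℝ)).hasFDerivAt
  have h2 := (hf.differentiable (by simp) x).hasFDerivAt
  have h3 : fderiv ℝ (fun x : EuclideanSpace ℝ ι => (x j : ℂ) * f x) x = _ := (h1.mul h2).fderiv
  simp only [UltraDiff.dPartial, h3, Pi.add_apply, Pi.smul_apply]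
  by_cases hij : i = j
  · subst hij
    simp
    ring
  · simp [hij, Ne.symm hij]
    ring

lemma contDiff_coord_mul (j : ι) {f : EuclideanSpace ℝ ι → ℂ} (hf : ContDiff ℝ (⊤ : ℕ∞) f) :
    ContDiff ℝ (⊤ : ℕ∞) (fun x => (x j : ℂ) * f x) :=
  ((Complex.ofRealCLM.comp
    (EuclideanSpace.proj j : EuclideanSpace ℝ ι →L[ℝ] ℝ)).contDiff).mul hf

/-- Without derivatives, |x_j| is absorbed by raising n to n + k. With derivatives, the commutator
of D_i and x_j is a constant, so each letter leaves x_j D_i T plus a multiple of T. -/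
lemma Tame.coord_mul (h : Tame ω T) (j : ι) : Tame ω (fun v x => (x j : ℂ) * T v x) := by
  refine ⟨fun v => contDiff_coord_mul j (h.1 v), fun n l => ?_⟩
  induction l generalizing T with
  | nil =>
    obtain ⟨k, C, hC, hk⟩ := exists_one_add_norm_pow_le ω 1
    obtain ⟨q, hq, hb⟩ := h.2 (n + k) []
    refine ⟨C.toNNReal • q, continuous_nnreal_smul hq _, fun v x => ?_⟩
    have hx : ‖x j‖ ≤ C * Real.exp (k * directSum ω x) := by
      refine le_trans ?_ (hk x)
      have := PiLp.norm_apply_le x j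
      linarith
    have hv := hb v x
    have e : (C.toNNReal • q) v = C * q v := by
      show ((C.toNNReal : ℝ≥0) : ℝ) * q v = _
      rw [Real.coe_toNNReal _ hC]
    rw [e]
    simp only [dWord] at hv ⊢
    rw [norm_mul, Complex.norm_real]
    calc Real.exp (n * directSum ω x) * (‖x j‖ * ‖T v x‖)
        ≤ Real.exp (n * directSum ω x) * (C * Real.exp (k * directSum ω x) * ‖T v x‖) := by gcongr
      _ = C * (Real.exp ((n + k : ℕ) * directSum ω x) * ‖T v x‖) := by
          push_cast
          rw [add_mul, Real.exp_add]
          ring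
      _ ≤ _ := by gcongr
  | cons i l ih =>
    classical
    obtain ⟨q, hq, hb⟩ := ih (h.dPartial i)
    obtain ⟨q', hq', hb'⟩ := (h.const_smul (if i = j then -Complex.I else 0)).2 n l
    refine ⟨q + q', continuous_seminorm_add hq hq', fun v x => ?_⟩
    simp only [dWord]
    rw [dPartial_coord_mul i j (h.1 v), dWord_add l
      (contDiff_coord_mul j (dPartial_smooth i (h.1 v)))
      (by exact contDiff_const.smul (h.1 v)), Pi.add_apply]
    refine le_trans ?_ (add_le_add (hb v x) (hb' v x))
    rw [← mul_add]
    gcongr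
    exact norm_add_le _ _

/-- The first moment needed to differentiate the Fourier integral. -/
lemma Tame.integrable_norm_mul (h : Tame ω T) (v : V) :
    Integrable (fun x => ‖x‖ * ‖T v x‖) := by
  obtain ⟨k, hk⟩ := exists_integrable_exp_neg ω
  obtain ⟨m, C, hC, hm⟩ := exists_one_add_norm_pow_le ω 1
  obtain ⟨q, -, hq⟩ := h.2 (m + k) []
  refine (hk.const_mul (C * q v)).mono'
    (continuous_norm.mul (h.1 v).continuous.norm).aestronglyMeasurable
    (Filter.Eventually.of_forall fun x => ?_)
  have h1 : Real.exp (m * directSum ω x + k * directSum ω x) * ‖T v x‖ ≤ q v := by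
    rw [← add_mul, ← Nat.cast_add]
    exact hq v x
  have h2 := hm x
  rw [pow_one] at h2
  rw [norm_mul, norm_norm, norm_norm]
  calc ‖x‖ * ‖T v x‖ ≤ (C * Real.exp (m * directSum ω x)) * ‖T v x‖ := by gcongr; linarith
    _ = C * (Real.exp (m * directSum ω x) * ‖T v x‖) := by ring
    _ ≤ C * (q v * Real.exp (-(k * directSum ω x))) := by
        exact mul_le_mul_of_nonneg_left (le_mul_exp_neg h1) hC
    _ = _ := by ring

end Tame

/-! ### Permutations of coordinates and reflection. -/

section Relabel

variable {ι : Type} [Fintype ι]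

/-- The map `x ↦ s • (x ∘ π⁻¹)`. -/
noncomputable def relabel (π : ι ≃ ι) (s : ℝ) : EuclideanSpace ℝ ι →L[ℝ] EuclideanSpace ℝ ι :=
  s • (LinearIsometryEquiv.piLpCongrLeft 2 ℝ ℝ π).toContinuousLinearEquiv.toContinuousLinearMap

lemma relabel_apply (π : ι ≃ ι) (s : ℝ) (x : EuclideanSpace ℝ ι) (j : ι) :
    relabel π s x j = s * x (π.symm j) := by
  simp [relabel, LinearIsometryEquiv.piLpCongrLeft_apply]

open Classical in
lemma relabel_single (π : ι ≃ ι) (s : ℝ) (j : ι) :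
    relabel π s (EuclideanSpace.single j 1) = s • EuclideanSpace.single (π j) 1 := by
  ext i
  rw [relabel_apply]
  simp [Equiv.symm_apply_eq]

lemma directSum_relabel (ω : ι → WeightFunction) (π : ι ≃ ι) {s : ℝ} (hs : |s| = 1)
    (x : EuclideanSpace ℝ ι) : directSum ω (relabel π s x) = directSum (ω ∘ π) x := by
  unfold directSum
  rw [← Equiv.sum_comp π]
  refine Finset.sum_congr rfl fun j _ => ?_
  have : ‖relabel π s x (π j)‖₊ = ‖x j‖₊ := by
    ext
    rw [relabel_apply]
    simp [hs]
  rw [this]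
  rfl

lemma dPartial_comp_relabel (π : ι ≃ ι) (s : ℝ) (j : ι) {f : EuclideanSpace ℝ ι → ℂ}
    (hf : ContDiff ℝ (⊤ : ℕ∞) f) :
    dPartial j (fun x => f (relabel π s x)) =
      (s : ℂ) • fun x => dPartial (π j) f (relabel π s x) := by
  funext x
  have h := (hf.differentiable (by simp) (relabel π s x)).hasFDerivAt.comp x
    (relabel π s).hasFDerivAt
  have h' : fderiv ℝ (fun x => f (relabel π s x)) x = _ := h.fderiv
  simp only [dPartial, h', Pi.smul_apply, ContinuousLinearMap.comp_apply, relabel_single, map_smul]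
  simp
  ring

variable {V : Type*} [AddCommGroup V] [Module ℂ V] [TopologicalSpace V]
  {ω : ι → WeightFunction} {T : V → EuclideanSpace ℝ ι → ℂ}

/-- Needed twice: with s = -1 and trivial π for the reflection in Fourier inversion, and with s = 1
for the swap of the two blocks. -/
lemma Tame.comp_relabel (h : Tame ω T) (π : ι ≃ ι) {s : ℝ} (hs : |s| = 1) :
    Tame (ω ∘ π) (fun v x => T v (relabel π s x)) := by
  refine ⟨fun v => (h.1 v).comp (relabel π s).contDiff, fun n l => ?_⟩
  induction l generalizing T with
  | nil =>
    obtain ⟨q, hq, hb⟩ := h.2 n []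
    refine ⟨q, hq, fun v x => ?_⟩
    rw [← directSum_relabel ω π hs]
    exact hb v _
  | cons j l ih =>
    obtain ⟨q, hq, hb⟩ := ih ((h.dPartial (π j)).const_smul (s : ℂ))
    refine ⟨q, hq, fun v x => ?_⟩
    simp only [dWord]
    rw [dPartial_comp_relabel π s j (h.1 v)]
    exact hb v x

end Relabel

/-! ### The Fourier transform on the space. -/

section Fourier

variable {ι : Type} [Fintype ι]

/-- The bilinear form for which `fourierT` is the Fourier integral of Mathlib. -/
noncomputable def fourierForm (ι : Type) [Fintype ι] :
    EuclideanSpace ℝ ι →L[ℝ] EuclideanSpace ℝ ι →L[ℝ] ℝ :=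
  (2 * Real.pi)⁻¹ • innerSL ℝ

lemma fourierForm_apply (x y : EuclideanSpace ℝ ι) :
    fourierForm ι x y = (2 * Real.pi)⁻¹ * inner ℝ x y := rfl

/-- The factor (2π)⁻¹ in the form cancels the 2π in the standard character. -/
lemma fourierChar_fourierForm (x ξ : EuclideanSpace ℝ ι) :
    (Real.fourierChar (-(fourierForm ι x ξ)) : ℂ) =
      Complex.exp (-(Complex.I * ((inner ℝ x ξ : ℝ) : ℂ))) := by
  rw [Real.fourierChar_apply, fourierForm_apply]
  congr 1
  push_cast
  have : (Real.pi : ℂ) ≠ 0 := by exact_mod_cast Real.pi_ne_zero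
  field_simp

lemma fourierT_eq (f : EuclideanSpace ℝ ι → ℂ) :
    fourierT f = VectorFourier.fourierIntegral Real.fourierChar volume
      (fourierForm ι).toLinearMap₁₂ f := by
  funext ξ
  simp only [fourierT, VectorFourier.fourierIntegral]
  refine integral_congr_ae (Filter.Eventually.of_forall fun x => ?_)
  simp only [Circle.smul_def, smul_eq_mul]
  rw [← fourierChar_fourierForm]
  rfl

lemma fourierT_eq_fourier (f : EuclideanSpace ℝ ι → ℂ) (ξ : EuclideanSpace ℝ ι) :
    fourierT f ξ = FourierTransform.fourier f ((2 * Real.pi)⁻¹ • ξ) := by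
  rw [Real.fourier_eq]
  simp only [fourierT]
  refine integral_congr_ae (Filter.Eventually.of_forall fun x => ?_)
  simp only [Circle.smul_def, smul_eq_mul]
  rw [← fourierChar_fourierForm, fourierForm_apply, inner_smul_right]

lemma fourierT_inversion {f : EuclideanSpace ℝ ι → ℂ} (hc : Continuous f) (hi : Integrable f)
    (hi' : Integrable (fourierT f)) (x : EuclideanSpace ℝ ι) :
    fourierT (fourierT f) x = ((2 * Real.pi) ^ Fintype.card ι : ℝ) * f (-x) := by
  have hpi : (2 * Real.pi) ≠ 0 := by positivity
  have h1 : FourierTransform.fourier f = fun ξ => fourierT f ((2 * Real.pi) • ξ) := by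
    funext ξ
    rw [fourierT_eq_fourier, smul_smul, inv_mul_cancel₀ hpi, one_smul]
  have h2 : Integrable (FourierTransform.fourier f) := by
    rw [h1]
    exact hi'.comp_smul hpi
  have h3 := congrFun (hc.fourierInv_fourier_eq hi h2) (-x)
  rw [← h3, Real.fourierInv_eq, h1]
  -- The Jacobian of the dilation by 2π is the source of the constant (2π)^d, where d is the number
  -- of coordinates.
  have h4 := Measure.integral_comp_smul (volume : Measure (EuclideanSpace ℝ ι))
    (fun ξ => Complex.exp (-(Complex.I * ((inner ℝ ξ x : ℝ) : ℂ))) * fourierT f ξ) (2 * Real.pi)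
  have h5 : ∀ v : EuclideanSpace ℝ ι, (Real.fourierChar (inner ℝ v (-x)) : Circle) •
      fourierT f ((2 * Real.pi) • v) = Complex.exp (-(Complex.I *
        ((inner ℝ ((2 * Real.pi) • v) x : ℝ) : ℂ))) * fourierT f ((2 * Real.pi) • v) := by
    intro v
    rw [Circle.smul_def, smul_eq_mul, Real.fourierChar_apply, inner_neg_right, inner_smul_left]
    congr 2
    simp
    ring
  simp only [h5]
  rw [h4, finrank_euclideanSpace, abs_of_pos (by positivity), Complex.real_smul, ← mul_assoc,
    ← Complex.ofReal_mul, mul_inv_cancel₀ (by positivity), Complex.ofReal_one, one_mul]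
  rfl

lemma hasFDerivAt_fourierT {f : EuclideanSpace ℝ ι → ℂ} (hi : Integrable f)
    (hi' : Integrable (fun x => ‖x‖ * ‖f x‖)) (ξ : EuclideanSpace ℝ ι) :
    HasFDerivAt (fourierT f) (VectorFourier.fourierIntegral Real.fourierChar volume
      (fourierForm ι).toLinearMap₁₂ (VectorFourier.fourierSMulRight (fourierForm ι) f) ξ) ξ := by
  rw [fourierT_eq]
  exact VectorFourier.hasFDerivAt_fourierIntegral (fourierForm ι) hi hi' ξ

lemma integrable_fourierSMulRight {f : EuclideanSpace ℝ ι → ℂ} (hi : Integrable f)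
    (hi' : Integrable (fun x => ‖x‖ * ‖f x‖)) :
    Integrable (VectorFourier.fourierSMulRight (fourierForm ι) f) := by
  refine (hi'.const_mul (2 * Real.pi * ‖fourierForm ι‖)).mono'
    hi.aestronglyMeasurable.fourierSMulRight (Filter.Eventually.of_forall fun x => ?_)
  rw [← mul_assoc]
  exact VectorFourier.norm_fourierSMulRight_le _ _ _

lemma dPartial_fourierT (j : ι) {f : EuclideanSpace ℝ ι → ℂ} (hi : Integrable f)
    (hi' : Integrable (fun x => ‖x‖ * ‖f x‖)) :
    dPartial j (fourierT f) = fourierT (fun x => (-1 : ℂ) * ((x j : ℂ) * f x)) := by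
  classical
  funext ξ
  rw [dPartial, (hasFDerivAt_fourierT hi hi' ξ).fderiv,
    Real.fourierIntegral_continuousLinearMap_apply' (integrable_fourierSMulRight hi hi'),
    fourierT_eq, ← smul_eq_mul, ← Pi.smul_apply, ← VectorFourier.fourierIntegral_const_smul]
  congr 1
  funext x
  have hpi : (Real.pi : ℂ) ≠ 0 := by exact_mod_cast Real.pi_ne_zero
  simp [fourierForm_apply, EuclideanSpace.inner_single_right]
  field_simp
  rw [Complex.I_sq]
  ring

lemma fourierT_dPartial (j : ι) {f : EuclideanSpace ℝ ι → ℂ} (hi : Integrable f)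
    (hd : Differentiable ℝ f) (hi' : Integrable (fderiv ℝ f)) :
    fourierT (dPartial j f) = fun ξ => (ξ j : ℂ) * fourierT f ξ := by
  classical
  funext ξ
  have h := congrFun (VectorFourier.fourierIntegral_fderiv (fourierForm ι) hi hd hi') ξ
  have h' := congrArg (fun L : EuclideanSpace ℝ ι →L[ℝ] ℂ => L (EuclideanSpace.single j 1)) h
  rw [Real.fourierIntegral_continuousLinearMap_apply' hi', ← fourierT_eq,
    ← fourierT_eq] at h'
  have e : dPartial j f = (-Complex.I) • fun x => fderiv ℝ f x (EuclideanSpace.single j 1) := rfl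
  rw [e, fourierT_smul, Pi.smul_apply, h']
  have hpi : (Real.pi : ℂ) ≠ 0 := by exact_mod_cast Real.pi_ne_zero
  simp [fourierForm_apply, EuclideanSpace.inner_single_left]
  field_simp
  rw [Complex.I_sq]
  ring

-- Lets integrability of the full differential be read off from the partial derivatives.
open Classical in
lemma norm_clm_le_sum (L : EuclideanSpace ℝ ι →L[ℝ] ℂ) :
    ‖L‖ ≤ ∑ j, ‖L (EuclideanSpace.single j 1)‖ := by
  refine L.opNorm_le_bound (Finset.sum_nonneg fun _ _ => norm_nonneg _) fun x => ?_
  conv_lhs => rw [← (EuclideanSpace.basisFun ι ℝ).sum_repr x]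
  rw [map_sum, Finset.sum_mul]
  refine (norm_sum_le _ _).trans (Finset.sum_le_sum fun j _ => ?_)
  rw [map_smul, norm_smul, mul_comm]
  simp only [EuclideanSpace.basisFun_repr, EuclideanSpace.basisFun_apply]
  gcongr
  exact PiLp.norm_apply_le x j

lemma norm_dPartial (j : ι) [DecidableEq ι] (f : EuclideanSpace ℝ ι → ℂ)
    (x : EuclideanSpace ℝ ι) :
    ‖dPartial j f x‖ = ‖fderiv ℝ f x (EuclideanSpace.single j 1)‖ := by
  rw [dPartial, norm_mul]
  simp
  congr!

/-- The map is orthogonal, so it preserves both the measure and the inner product in the phase. -/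
lemma fourierT_comp_relabel (π : ι ≃ ι) {s : ℝ} (hs : |s| = 1) (f : EuclideanSpace ℝ ι → ℂ) :
    fourierT (fun x => f (relabel π s x)) = fun ξ => fourierT f (relabel π s ξ) := by
  have hs' : s * s = 1 := by rw [← abs_mul_abs_self, hs, one_mul]
  funext ξ
  have hinner : ∀ x y : EuclideanSpace ℝ ι,
      inner ℝ (relabel π s x) (relabel π s y) = (inner ℝ x y : ℝ) := by
    intro x y
    simp only [PiLp.inner_apply, relabel_apply]
    rw [← Equiv.sum_comp π]
    refine Finset.sum_congr rfl fun j _ => ?_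
    simp
    linear_combination (y j * x j) * hs'
  let L : EuclideanSpace ℝ ι ≃ₗᵢ[ℝ] EuclideanSpace ℝ ι :=
    { toFun := relabel π s
      invFun := relabel π.symm s
      left_inv := fun x => by
        ext j
        simp only [relabel_apply, Equiv.symm_symm, Equiv.symm_apply_apply]
        rw [← mul_assoc, hs', one_mul]
      right_inv := fun x => by
        ext j
        simp only [relabel_apply, Equiv.symm_symm, Equiv.apply_symm_apply]
        rw [← mul_assoc, hs', one_mul]
      map_add' := map_add _
      map_smul' := fun c x => map_smul _ c x
      norm_map' := fun x => by
        have := hinner x x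
        rw [real_inner_self_eq_norm_sq, real_inner_self_eq_norm_sq] at this
        exact (pow_left_inj₀ (norm_nonneg _) (norm_nonneg _) two_ne_zero).1 this }
  have hL := L.measurePreserving.integral_comp' (f := L.toMeasurableEquiv)
    (fun x => Complex.exp (-(Complex.I * ((inner ℝ x (relabel π s ξ) : ℝ) : ℂ))) * f x)
  simp only [fourierT]
  rw [← hL]
  refine integral_congr_ae (Filter.Eventually.of_forall fun x => ?_)
  have : (L.toMeasurableEquiv x) = relabel π s x := rfl
  simp only [this, hinner]

lemma relabel_refl_neg_one (x : EuclideanSpace ℝ ι) : relabel (Equiv.refl ι) (-1) x = -x := by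
  ext j
  simp [relabel_apply]

variable {ω σ : ι → WeightFunction}

lemma integrable_fderiv_swo (f : Swo ω σ) : Integrable (fderiv ℝ f.1) := by
  classical
  refine (integrable_finsetSum Finset.univ fun j _ =>
    (((tame_swo ω σ).dPartial j).integrable f).norm).mono' ?_
    (Filter.Eventually.of_forall fun x => ?_)
  · exact (f.2.2.1.1.continuous_fderiv (by simp)).aestronglyMeasurable
  · refine (norm_clm_le_sum _).trans (le_of_eq (Finset.sum_congr rfl fun j _ => ?_))
    rw [norm_dPartial]

lemma fourierT_fourierT_swo (f : Swo ω σ) : fourierT (fourierT f.1) =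
    (((2 * Real.pi) ^ Fintype.card ι : ℝ) : ℂ) •
      fun x => f.1 (relabel (Equiv.refl ι) (-1) x) := by
  funext x
  rw [fourierT_inversion f.2.2.1.1.continuous f.2.1 ((tame_swo_fourier ω σ).integrable f)]
  rw [Pi.smul_apply, relabel_refl_neg_one, smul_eq_mul]

/-- The two decay conditions change roles: by inversion the double transform is a multiple of the
reflected f, which decays with respect to ω. -/
lemma exists_fourier_clm (ω σ : ι → WeightFunction) :
    ∃ S : Swo ω σ →L[ℂ] Swo σ ω, ∀ f, (S f).1 = fourierT f.1 := by
  refine exists_continuousLinearMap (T := fun f : Swo ω σ => fourierT f.1)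
    (fun f g => fourierT_add f.2.1 g.2.1) (fun c f => fourierT_smul c f.1)
    (tame_swo_fourier ω σ).integrable (tame_swo_fourier ω σ) ?_
  simp only [fourierT_fourierT_swo]
  exact ((tame_swo ω σ).comp_relabel (Equiv.refl ι) (by simp)).const_smul _

/-- The transform turns D_j into multiplication by ξ_j, which preserves decay with respect to σ. -/
lemma exists_dPartial_clm (ω σ : ι → WeightFunction) (j : ι) :
    ∃ S : Swo ω σ →L[ℂ] Swo ω σ, ∀ f, (S f).1 = dPartial j f.1 := by
  refine exists_continuousLinearMap (T := fun f : Swo ω σ => dPartial j f.1)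
    (fun f g => dPartial_add j f.2.2.1.1 g.2.2.1.1) (fun c f => dPartial_smul j c f.2.2.1.1)
    ((tame_swo ω σ).dPartial j).integrable ((tame_swo ω σ).dPartial j) ?_
  have e : ∀ f : Swo ω σ, fourierT (dPartial j f.1) = fun ξ => (ξ j : ℂ) * fourierT f.1 ξ :=
    fun f => fourierT_dPartial j f.2.1 (f.2.2.1.1.differentiable (by simp))
      (integrable_fderiv_swo f)
  simp only [e]
  exact (tame_swo_fourier ω σ).coord_mul j

lemma exists_neg_coord_mul_clm (ω σ : ι → WeightFunction) (j : ι) :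
    ∃ S : Swo ω σ →L[ℂ] Swo ω σ, ∀ f, (S f).1 = fun x => (-1 : ℂ) * ((x j : ℂ) * f.1 x) := by
  have ht := ((tame_swo ω σ).coord_mul j).const_smul (-1)
  refine exists_continuousLinearMap
    (T := fun f : Swo ω σ => fun x => (-1 : ℂ) * ((x j : ℂ) * f.1 x)) ?_ ?_
    ht.integrable ht ?_
  · intro f g
    funext x
    show (-1 : ℂ) * ((x j : ℂ) * (f.1 x + g.1 x)) = _
    simp only [Pi.add_apply]
    ring
  · intro c f
    funext x
    show (-1 : ℂ) * ((x j : ℂ) * (c * f.1 x)) = c * _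
    ring
  · have e : ∀ f : Swo ω σ, fourierT (fun x => (-1 : ℂ) * ((x j : ℂ) * f.1 x)) =
        dPartial j (fourierT f.1) :=
      fun f => (dPartial_fourierT j f.2.1 ((tame_swo ω σ).integrable_norm_mul f)).symm
    simp only [e]
    exact (tame_swo_fourier ω σ).dPartial j

lemma exists_relabel_clm (ω σ : ι → WeightFunction) (π : ι ≃ ι) :
    ∃ S : Swo ω σ →L[ℂ] Swo (ω ∘ π) (σ ∘ π), ∀ f, (S f).1 = fun x => f.1 (relabel π 1 x) := by
  have ht := (tame_swo ω σ).comp_relabel π (s := 1) (by simp)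
  refine exists_continuousLinearMap
    (T := fun f : Swo ω σ => fun x => f.1 (relabel π 1 x)) (fun _ _ => rfl) (fun _ _ => rfl)
    ht.integrable ht ?_
  simp only [fourierT_comp_relabel π (s := 1) (by simp)]
  exact (tame_swo_fourier ω σ).comp_relabel π (s := 1) (by simp)

end Fourier

/-! ### Fubini on the two blocks, and the multiplication formula. -/

section Blocks

variable {N : ℕ}

/-- The volume preserving identification `ℝ^N × ℝ^N ≃ ℝ^{2N}`. -/
noncomputable def pairEquiv (N : ℕ) :
    (EuclideanSpace ℝ (Fin N) × EuclideanSpace ℝ (Fin N)) ≃ᵐ R2 N :=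
  (MeasurableEquiv.prodCongr (MeasurableEquiv.toLp 2 (Fin N → ℝ)).symm
    (MeasurableEquiv.toLp 2 (Fin N → ℝ)).symm).trans
    ((MeasurableEquiv.sumPiEquivProdPi (fun _ : Fin N ⊕ Fin N => ℝ)).symm.trans
      (MeasurableEquiv.toLp 2 (Fin N ⊕ Fin N → ℝ)))

lemma pairEquiv_apply (p : EuclideanSpace ℝ (Fin N) × EuclideanSpace ℝ (Fin N)) :
    pairEquiv N p = pair p.1 p.2 := by
  ext i
  rcases i with i | i <;> rfl

lemma measurePreserving_pairEquiv (N : ℕ) : MeasurePreserving (pairEquiv N) := by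
  refine MeasurePreserving.trans (MeasurePreserving.prod
    (EuclideanSpace.volume_preserving_symm_measurableEquiv_toLp _)
    (EuclideanSpace.volume_preserving_symm_measurableEquiv_toLp _)) ?_
  exact (volume_measurePreserving_sumPiEquivProdPi_symm _).trans
    (EuclideanSpace.volume_preserving_symm_measurableEquiv_toLp _).symm

@[simp] lemma fstBlock_pair (x y : EuclideanSpace ℝ (Fin N)) : fstBlock (pair x y) = x := rfl

@[simp] lemma sndBlock_pair (x y : EuclideanSpace ℝ (Fin N)) : sndBlock (pair x y) = y := rfl

lemma pair_fstBlock_sndBlock (z : R2 N) : pair (fstBlock z) (sndBlock z) = z := by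
  ext i
  rcases i with i | i <;> rfl

lemma inner_pair (x y : EuclideanSpace ℝ (Fin N)) (z : R2 N) :
    inner ℝ (pair x y) z = (inner ℝ x (fstBlock z) + inner ℝ y (sndBlock z) : ℝ) := by
  simp only [PiLp.inner_apply, Fintype.sum_sum_type]
  rfl

lemma integrable_pair {G : R2 N → ℂ} (hG : Integrable G) :
    Integrable (fun p : EuclideanSpace ℝ (Fin N) × EuclideanSpace ℝ (Fin N) => G (pair p.1 p.2))
      (volume.prod volume) := by
  have := ((measurePreserving_pairEquiv N).integrable_comp_emb
    (pairEquiv N).measurableEmbedding).2 hG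
  simp only [Function.comp_def, pairEquiv_apply] at this
  exact this

lemma integral_R2_eq {G : R2 N → ℂ} (hG : Integrable G) :
    ∫ z, G z = ∫ x : EuclideanSpace ℝ (Fin N), ∫ y : EuclideanSpace ℝ (Fin N), G (pair x y) := by
  rw [← (measurePreserving_pairEquiv N).integral_comp' G]
  simp only [pairEquiv_apply]
  exact integral_prod _ (integrable_pair hG)

lemma integral_R2_eq_symm {G : R2 N → ℂ} (hG : Integrable G) :
    ∫ z, G z = ∫ y : EuclideanSpace ℝ (Fin N), ∫ x : EuclideanSpace ℝ (Fin N), G (pair x y) := by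
  rw [← (measurePreserving_pairEquiv N).integral_comp' G]
  simp only [pairEquiv_apply]
  exact integral_prod_symm _ (integrable_pair hG)

lemma exp_inner_pair (x y : EuclideanSpace ℝ (Fin N)) (z : R2 N) :
    Complex.exp (-(Complex.I * ((inner ℝ (pair x y) z : ℝ) : ℂ))) =
      Complex.exp (-(Complex.I * ((inner ℝ x (fstBlock z) : ℝ) : ℂ))) *
        Complex.exp (-(Complex.I * ((inner ℝ y (sndBlock z) : ℝ) : ℂ))) := by
  rw [inner_pair, ← Complex.exp_add]
  congr 1
  push_cast
  ring

/-- Fubini, as the phase factors over the blocks; the companion below integrates in the other order.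
-/
lemma fourierT_eq_partialFourier₁₂ {G : R2 N → ℂ} (hG : Integrable G) :
    fourierT G = partialFourier₁ (partialFourier₂ G) := by
  funext z
  rw [fourierT, integral_R2_eq (exp_fourier_integrable hG z)]
  simp only [partialFourier₁, partialFourier₂, exp_inner_pair, mul_assoc, integral_const_mul,
    fstBlock_pair, sndBlock_pair]

lemma fourierT_eq_partialFourier₂₁ {G : R2 N → ℂ} (hG : Integrable G) :
    fourierT G = partialFourier₂ (partialFourier₁ G) := by
  funext z
  rw [fourierT, integral_R2_eq_symm (exp_fourier_integrable hG z)]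
  simp only [partialFourier₁, partialFourier₂, exp_inner_pair, mul_assoc, integral_const_mul,
    fstBlock_pair, sndBlock_pair, mul_left_comm (Complex.exp (-(Complex.I *
      ((inner ℝ (_ : EuclideanSpace ℝ (Fin N)) (fstBlock z) : ℝ) : ℂ)))) (Complex.exp _)]

lemma partialFourier₁_apply (F : R2 N → ℂ) (z : R2 N) :
    partialFourier₁ F z = fourierT (fun x => F (pair x (sndBlock z))) (fstBlock z) := rfl

lemma partialFourier₂_apply (F : R2 N → ℂ) (z : R2 N) :
    partialFourier₂ F z = fourierT (fun y => F (pair (fstBlock z) y)) (sndBlock z) := rfl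

lemma directSum_pair (ω : Fin N ⊕ Fin N → WeightFunction) (x y : EuclideanSpace ℝ (Fin N)) :
    directSum ω (pair x y) =
      directSum (fun j => ω (Sum.inl j)) x + directSum (fun j => ω (Sum.inr j)) y := by
  simp only [directSum, Fintype.sum_sum_type]
  rfl

lemma norm_fourierT_le {ι : Type} [Fintype ι] (f : EuclideanSpace ℝ ι → ℂ)
    (ξ : EuclideanSpace ℝ ι) : ‖fourierT f ξ‖ ≤ ∫ x, ‖f x‖ := by
  refine (norm_integral_le_integral_norm _).trans (le_of_eq ?_)
  refine integral_congr_ae (Filter.Eventually.of_forall fun x => ?_)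
  simp [Complex.norm_exp]

/-- Fubini for the double integral with the phase; the phase is symmetric, so the flipped transform
is the same one. -/
lemma integral_mul_fourierT {ι : Type} [Fintype ι] {f g : EuclideanSpace ℝ ι → ℂ}
    (hf : Integrable f) (hg : Integrable g) :
    ∫ x, f x * fourierT g x = ∫ x, fourierT f x * g x := by
  have h := VectorFourier.integral_fourierIntegral_smul_eq_flip (μ := volume) (ν := volume)
    (L := (fourierForm ι).toLinearMap₁₂) Real.continuous_fourierChar
    (fourierForm ι).continuous₂ hf hg
  have hflip : (fourierForm ι).toLinearMap₁₂.flip = (fourierForm ι).toLinearMap₁₂ := by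
    ext x y
    show fourierForm ι y x = fourierForm ι x y
    rw [fourierForm_apply, fourierForm_apply, real_inner_comm]
  rw [hflip, ← fourierT_eq, ← fourierT_eq] at h
  simpa only [smul_eq_mul] using h.symm

end Blocks

/-! ### Bounds on slices, uniform in the other block. -/

section Slices

variable {N : ℕ} {V : Type*} [AddCommGroup V] [Module ℂ V] [TopologicalSpace V]
  {ω : Fin N ⊕ Fin N → WeightFunction} {T : V → R2 N → ℂ}

lemma continuous_pair : Continuous
    (fun p : EuclideanSpace ℝ (Fin N) × EuclideanSpace ℝ (Fin N) => pair p.1 p.2) := by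
  refine (PiLp.continuous_toLp 2 _).comp (continuous_pi fun i => ?_)
  rcases i with i | i
  · exact (EuclideanSpace.proj i : EuclideanSpace ℝ (Fin N) →L[ℝ] ℝ).continuous.comp continuous_fst
  · exact (EuclideanSpace.proj i : EuclideanSpace ℝ (Fin N) →L[ℝ] ℝ).continuous.comp continuous_snd

/-- Start from the bound with n + k: n is kept on the first block, and k on the second block becomes
the integrable majorant, which depends neither on x nor on v. -/
lemma Tame.exists_slice_bound_snd (h : Tame ω T) (n : ℕ) :
    ∃ q : Seminorm ℂ V, Continuous q ∧ ∃ g : EuclideanSpace ℝ (Fin N) → ℝ, Integrable g ∧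
      ∀ v x y, Real.exp (n * directSum (fun j => ω (Sum.inl j)) x) * ‖T v (pair x y)‖ ≤
        q v * g y := by
  obtain ⟨k, hk⟩ := exists_integrable_exp_neg fun j => ω (Sum.inr j)
  obtain ⟨q, hq, hb⟩ := h.2 (n + k) []
  refine ⟨q, hq, _, hk, fun v x y => le_mul_exp_neg (le_trans ?_ (hb v (pair x y)))⟩
  have h1 := directSum_nonneg (fun j => ω (Sum.inl j)) x
  have h2 := directSum_nonneg (fun j => ω (Sum.inr j)) y
  have h3 : (0 : ℝ) ≤ n := Nat.cast_nonneg n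
  have h4 : (0 : ℝ) ≤ k := Nat.cast_nonneg k
  refine mul_le_mul_of_nonneg_right (Real.exp_le_exp.2 ?_) (norm_nonneg _)
  rw [directSum_pair]
  push_cast
  nlinarith [mul_nonneg h3 h2, mul_nonneg h4 h1]

lemma Tame.exists_slice_bound_fst (h : Tame ω T) (n : ℕ) :
    ∃ q : Seminorm ℂ V, Continuous q ∧ ∃ g : EuclideanSpace ℝ (Fin N) → ℝ, Integrable g ∧
      ∀ v x y, Real.exp (n * directSum (fun j => ω (Sum.inr j)) y) * ‖T v (pair x y)‖ ≤
        q v * g x := by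
  obtain ⟨k, hk⟩ := exists_integrable_exp_neg fun j => ω (Sum.inl j)
  obtain ⟨q, hq, hb⟩ := h.2 (n + k) []
  refine ⟨q, hq, _, hk, fun v x y => le_mul_exp_neg (le_trans ?_ (hb v (pair x y)))⟩
  have h1 := directSum_nonneg (fun j => ω (Sum.inl j)) x
  have h2 := directSum_nonneg (fun j => ω (Sum.inr j)) y
  have h3 : (0 : ℝ) ≤ n := Nat.cast_nonneg n
  have h4 : (0 : ℝ) ≤ k := Nat.cast_nonneg k
  refine mul_le_mul_of_nonneg_right (Real.exp_le_exp.2 ?_) (norm_nonneg _)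
  rw [directSum_pair]
  push_cast
  nlinarith [mul_nonneg h3 h1, mul_nonneg h4 h2]

lemma Tame.integrable_slice_snd (h : Tame ω T) (v : V) (x : EuclideanSpace ℝ (Fin N)) :
    Integrable (fun y => T v (pair x y)) := by
  obtain ⟨q, -, g, hg, hb⟩ := h.exists_slice_bound_snd 0
  refine (hg.const_mul (q v)).mono' ((h.1 v).continuous.comp
    (continuous_pair.comp (Continuous.prodMk_right x))).aestronglyMeasurable
    (Filter.Eventually.of_forall fun y => ?_)
  simpa using hb v x y

lemma Tame.integrable_slice_fst (h : Tame ω T) (v : V) (y : EuclideanSpace ℝ (Fin N)) :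
    Integrable (fun x => T v (pair x y)) := by
  obtain ⟨q, -, g, hg, hb⟩ := h.exists_slice_bound_fst 0
  refine (hg.const_mul (q v)).mono' ((h.1 v).continuous.comp
    (continuous_pair.comp (Continuous.prodMk_left y))).aestronglyMeasurable
    (Filter.Eventually.of_forall fun x => ?_)
  simpa using hb v x y

/-- First half of the core estimate: x is only a parameter of the integral, so decay in x survives.
-/
lemma Tame.exists_partialFourier₂_bound_fst (h : Tame ω T) (n : ℕ) :
    ∃ q : Seminorm ℂ V, Continuous q ∧ ∀ v z,
      Real.exp (n * directSum (fun j => ω (Sum.inl j)) (fstBlock z)) *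
        ‖partialFourier₂ (T v) z‖ ≤ q v := by
  obtain ⟨q, hq, g, hg, hb⟩ := h.exists_slice_bound_snd n
  refine ⟨‖∫ y, g y‖₊ • q, continuous_nnreal_smul hq _, fun v z => ?_⟩
  calc _ ≤ Real.exp (n * directSum (fun j => ω (Sum.inl j)) (fstBlock z)) *
        ∫ y, ‖T v (pair (fstBlock z) y)‖ := by
        rw [partialFourier₂_apply]
        gcongr
        exact norm_fourierT_le _ _
    _ = ∫ y, Real.exp (n * directSum (fun j => ω (Sum.inl j)) (fstBlock z)) *
        ‖T v (pair (fstBlock z) y)‖ := (integral_const_mul _ _).symm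
    _ ≤ ∫ y, q v * g y := by
        refine integral_mono ((h.integrable_slice_snd v _).norm.const_mul _)
          (hg.const_mul _) fun y => hb v _ y
    _ = q v * ∫ y, g y := integral_const_mul _ _
    _ ≤ ‖∫ y, g y‖ * q v := by
        rw [mul_comm]
        exact mul_le_mul_of_nonneg_right (Real.le_norm_self _) (apply_nonneg q v)

/-- Second half of the core estimate; it is applied to f̂ and the weights σ. -/
lemma Tame.exists_integral_norm_bound_snd (h : Tame ω T) (n : ℕ) :
    ∃ q : Seminorm ℂ V, Continuous q ∧ ∀ v y,
      Real.exp (n * directSum (fun j => ω (Sum.inr j)) y) *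
        ∫ x, ‖T v (pair x y)‖ ≤ q v := by
  obtain ⟨q, hq, g, hg, hb⟩ := h.exists_slice_bound_fst n
  refine ⟨‖∫ x, g x‖₊ • q, continuous_nnreal_smul hq _, fun v y => ?_⟩
  calc _ = ∫ x, Real.exp (n * directSum (fun j => ω (Sum.inr j)) y) *
        ‖T v (pair x y)‖ := (integral_const_mul _ _).symm
    _ ≤ ∫ x, q v * g x := by
        refine integral_mono ((h.integrable_slice_fst v _).norm.const_mul _)
          (hg.const_mul _) fun x => hb v x y
    _ = q v * ∫ x, g x := integral_const_mul _ _
    _ ≤ ‖∫ x, g x‖ * q v := by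
        rw [mul_comm]
        exact mul_le_mul_of_nonneg_right (Real.le_norm_self _) (apply_nonneg q v)

end Slices

/-! ### Differentiating the partial transform. -/

section Derivative

variable {N : ℕ} {ω σ : Fin N ⊕ Fin N → WeightFunction}

/-- The projection to the first block followed by the embedding of `ℝ^N × {0}`. -/
noncomputable def fstProj (N : ℕ) : R2 N →L[ℝ] R2 N :=
  LinearMap.toContinuousLinearMap
    { toFun := fun z => pair (fstBlock z) 0
      map_add' := fun z w => by
        ext i
        rcases i with i | i
        · rfl
        · exact (add_zero (0 : ℝ)).symm
      map_smul' := fun c z => by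
        ext i
        rcases i with i | i
        · rfl
        · exact (mul_zero c).symm }

lemma pair_eq_fstProj_add (z : R2 N) (y : EuclideanSpace ℝ (Fin N)) :
    pair (fstBlock z) y = fstProj N z + pair 0 y := by
  ext i
  rcases i with i | i
  · exact (add_zero (z (Sum.inl i))).symm
  · exact (zero_add (y i)).symm

/-- The functional `z ↦ y · z₂`, where `z₂` is the second block of `z`. -/
noncomputable def innerSnd (y : EuclideanSpace ℝ (Fin N)) : R2 N →L[ℝ] ℝ :=
  innerSL ℝ (pair 0 y)

lemma innerSnd_apply (y : EuclideanSpace ℝ (Fin N)) (z : R2 N) :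
    innerSnd y z = inner ℝ y (sndBlock z) := by
  show inner ℝ (pair 0 y) z = _
  rw [inner_pair, inner_zero_left, zero_add]

/-- The functional `z ↦ i z_j`. -/
noncomputable def coordI {ι : Type} [Fintype ι] (j : ι) : EuclideanSpace ℝ ι →L[ℝ] ℂ :=
  Complex.I • Complex.ofRealCLM.comp (EuclideanSpace.proj j : EuclideanSpace ℝ ι →L[ℝ] ℝ)

lemma coordI_apply {ι : Type} [Fintype ι] (j : ι) (x : EuclideanSpace ℝ ι) :
    coordI j x = Complex.I * (x j : ℂ) := rfl

lemma dPartial_apply {ι : Type} [Fintype ι] [DecidableEq ι] (j : ι) (f : EuclideanSpace ℝ ι → ℂ)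
    (x : EuclideanSpace ℝ ι) :
    dPartial j f x = -Complex.I * fderiv ℝ f x (EuclideanSpace.single j 1) := by
  rw [dPartial]
  congr!

/-- Since ∂_j = i D_j, the differential is expressed through the D_j with the factor i placed in
`coordI`. -/
lemma hasFDerivAt_of_dPartial {ι : Type} [Fintype ι] {f : EuclideanSpace ℝ ι → ℂ}
    {x : EuclideanSpace ℝ ι} (hf : DifferentiableAt ℝ f x) :
    HasFDerivAt f (∑ j, dPartial j f x • coordI j) x := by
  classical
  have h := hf.hasFDerivAt
  convert! h using 1
  refine ContinuousLinearMap.ext fun v => ?_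
  conv_rhs => rw [← (EuclideanSpace.basisFun ι ℝ).sum_repr v]
  rw [map_sum, sum_apply]
  refine Finset.sum_congr rfl fun j _ => ?_
  rw [map_smul, smul_apply, coordI_apply, dPartial_apply]
  simp only [EuclideanSpace.basisFun_repr, EuclideanSpace.basisFun_apply, smul_eq_mul,
    Complex.real_smul]
  linear_combination (-(fderiv ℝ f x (EuclideanSpace.single j 1)) * v j) * Complex.I_mul_I

lemma dPartial_eq_of_hasFDerivAt {ι : Type} [Fintype ι] {f : EuclideanSpace ℝ ι → ℂ}
    {x : EuclideanSpace ℝ ι} {g : ι → ℂ} (hf : HasFDerivAt f (∑ j, g j • coordI j) x) (i : ι) :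
    dPartial i f x = g i := by
  classical
  rw [dPartial, hf.fderiv, sum_apply, Finset.sum_eq_single i]
  · simp only [smul_apply, coordI_apply, smul_eq_mul]
    simp
    linear_combination (-(g i)) * Complex.I_mul_I
  · intro j _ hj
    simp [coordI_apply, hj]
  · simp

/-- The operators which the partial Fourier transform in the second block turns into the
operators `D_j`: `D_j` in the first block, multiplication by `-z_j` in the second one. -/
noncomputable def preDeriv (f : R2 N → ℂ) : Fin N ⊕ Fin N → R2 N → ℂ
  | Sum.inl j => dPartial (Sum.inl j) f
  | Sum.inr j => fun z => (-1 : ℂ) * ((z (Sum.inr j) : ℂ) * f z)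

lemma exists_preDeriv_clm (ω σ : Fin N ⊕ Fin N → WeightFunction) (j : Fin N ⊕ Fin N) :
    ∃ S : Swo ω σ →L[ℂ] Swo ω σ, ∀ f, (S f).1 = preDeriv f.1 j := by
  rcases j with j | j
  · exact exists_dPartial_clm ω σ _
  · exact exists_neg_coord_mul_clm ω σ _

/-- The integrand of the partial Fourier transform in the second block. -/
noncomputable def kernel₂ (f : R2 N → ℂ) (z : R2 N) (y : EuclideanSpace ℝ (Fin N)) : ℂ :=
  Complex.exp (-(Complex.I * ((inner ℝ y (sndBlock z) : ℝ) : ℂ))) * f (pair (fstBlock z) y)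

lemma norm_kernel₂ (f : R2 N → ℂ) (z : R2 N) (y : EuclideanSpace ℝ (Fin N)) :
    ‖kernel₂ f z y‖ = ‖f (pair (fstBlock z) y)‖ := by
  simp [kernel₂, Complex.norm_exp]

/-- In the first block the derivative falls on f; in the second it falls on the phase, where D_j
produces (-i)(-i y_j) = -y_j. -/
lemma hasFDerivAt_kernel₂ {f : R2 N → ℂ} (hf : Differentiable ℝ f) (z : R2 N)
    (y : EuclideanSpace ℝ (Fin N)) :
    HasFDerivAt (fun z => kernel₂ f z y) (∑ j, kernel₂ (preDeriv f j) z y • coordI j) z := by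
  have h1 : HasFDerivAt
      (fun z : R2 N => Complex.exp (-(Complex.I * ((inner ℝ y (sndBlock z) : ℝ) : ℂ))))
      (Complex.exp (-(Complex.I * ((inner ℝ y (sndBlock z) : ℝ) : ℂ))) •
        ((-Complex.I) • Complex.ofRealCLM.comp (innerSnd y))) z := by
    have h := ((Complex.ofRealCLM.comp (innerSnd y)).hasFDerivAt (x := z)).const_mul (-Complex.I)
    have h' := h.cexp
    simp only [ContinuousLinearMap.comp_apply, Complex.ofRealCLM_apply, innerSnd_apply,
      neg_mul] at h'
    exact h'
  have h2 : HasFDerivAt (fun z : R2 N => f (pair (fstBlock z) y))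
      ((fderiv ℝ f (pair (fstBlock z) y)).comp (fstProj N)) z := by
    have h : HasFDerivAt (fun z : R2 N => pair (fstBlock z) y) (fstProj N) z := by
      simp only [pair_eq_fstProj_add]
      exact (fstProj N).hasFDerivAt.add_const _
    exact (hf _).hasFDerivAt.comp z h
  have h3 : HasFDerivAt (fun z => kernel₂ f z y) _ z := h1.mul h2
  have h4 := hasFDerivAt_of_dPartial h3.differentiableAt
  convert! h4 using 1
  refine Finset.sum_congr rfl fun j _ => ?_
  congr 1
  rw [dPartial_apply, h3.fderiv]
  rcases j with j | j
  · have e1 : fstProj N (EuclideanSpace.single (Sum.inl j) 1) =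
        EuclideanSpace.single (Sum.inl j) 1 := by
      ext i
      rcases i with i | i
      · rfl
      · simp [fstProj, pair]
    have e2 : innerSnd y (EuclideanSpace.single (Sum.inl j) 1) = 0 := by
      rw [innerSnd_apply, PiLp.inner_apply]
      refine Finset.sum_eq_zero fun i _ => ?_
      simp [sndBlock]
    simp only [kernel₂, preDeriv, dPartial_apply, add_apply, smul_apply,
      ContinuousLinearMap.comp_apply, e1, e2, smul_eq_mul, map_zero]
    ring
  · have e1 : fstProj N (EuclideanSpace.single (Sum.inr j) 1) = 0 := by
      ext i
      rcases i with i | i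
      · simp [fstProj, pair, fstBlock]
      · simp [fstProj, pair]
    have e2 : innerSnd y (EuclideanSpace.single (Sum.inr j) 1) = y j := by
      rw [innerSnd_apply, PiLp.inner_apply]
      simp [sndBlock]
    have e3 : pair (fstBlock z) y (Sum.inr j) = y j := rfl
    simp only [kernel₂, preDeriv, add_apply, smul_apply,
      ContinuousLinearMap.comp_apply, e1, e2, e3, smul_eq_mul, map_zero, Complex.ofRealCLM_apply]
    linear_combination (-(f (pair (fstBlock z) y) *
      Complex.exp (-(Complex.I * ((inner ℝ y (sndBlock z) : ℝ) : ℂ))) * y j)) * Complex.I_mul_I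

lemma integrable_sum_smul_const {α κ G : Type*} [MeasurableSpace α] {μ : Measure α} [Fintype κ]
    [NormedAddCommGroup G] [NormedSpace ℂ G] {a : κ → α → ℂ} (ha : ∀ j, Integrable (a j) μ)
    (L : κ → G) : Integrable (fun y => ∑ j, a j y • L j) μ :=
  integrable_finsetSum _ fun j _ => (ha j).smul_const (L j)

lemma integral_sum_smul_const {α κ G : Type*} [MeasurableSpace α] {μ : Measure α} [Fintype κ]
    [NormedAddCommGroup G] [NormedSpace ℝ G] [NormedSpace ℂ G] [CompleteSpace G]
    {a : κ → α → ℂ} (ha : ∀ j, Integrable (a j) μ) (L : κ → G) :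
    ∫ y, ∑ j, a j y • L j ∂μ = ∑ j, (∫ y, a j y ∂μ) • L j := by
  rw [integral_finsetSum _ fun j _ => (ha j).smul_const (L j)]
  exact Finset.sum_congr rfl fun j _ => integral_smul_const _ _

/-- Differentiation under the integral: the phase has modulus one, so the g_j give an integrable
majorant independent of z. -/
lemma hasFDerivAt_partialFourier₂_of_bound {f : R2 N → ℂ} (hf : Differentiable ℝ f)
    (hi : ∀ x, Integrable fun y => f (pair x y))
    (hi' : ∀ j x, Integrable fun y => preDeriv f j (pair x y))
    {g : Fin N ⊕ Fin N → EuclideanSpace ℝ (Fin N) → ℝ} (hg : ∀ j, Integrable (g j))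
    (hb : ∀ j x y, ‖preDeriv f j (pair x y)‖ ≤ g j y) (z : R2 N) :
    HasFDerivAt (partialFourier₂ f) (∑ j, partialFourier₂ (preDeriv f j) z • coordI j) z := by
  have hslice : ∀ j z, Integrable (kernel₂ (preDeriv f j) z) := fun j z =>
    exp_fourier_integrable (hi' j (fstBlock z)) (sndBlock z)
  have hslice0 : ∀ z, Integrable (kernel₂ f z) := fun z =>
    exp_fourier_integrable (hi (fstBlock z)) (sndBlock z)
  have hint : ∀ z, Integrable (fun y => ∑ j, kernel₂ (preDeriv f j) z y •
      (coordI j : R2 N →L[ℝ] ℂ)) :=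
    fun z => integrable_sum_smul_const (fun j => hslice j z) _
  have hbound : ∀ y z, ‖∑ j, kernel₂ (preDeriv f j) z y • (coordI j : R2 N →L[ℝ] ℂ)‖ ≤
      ∑ j, g j y * ‖(coordI j : R2 N →L[ℝ] ℂ)‖ := fun y z => by
    refine (norm_sum_le _ _).trans (Finset.sum_le_sum fun j _ => ?_)
    rw [norm_smul, norm_kernel₂]
    exact mul_le_mul_of_nonneg_right (hb j _ y) (norm_nonneg _)
  have hbi : Integrable fun y => ∑ j, g j y * ‖(coordI j : R2 N →L[ℝ] ℂ)‖ :=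
    integrable_finsetSum _ fun j _ => (hg j).mul_const _
  have key : HasFDerivAt (fun z => ∫ y, kernel₂ f z y)
      (∫ y, ∑ j, kernel₂ (preDeriv f j) z y • (coordI j : R2 N →L[ℝ] ℂ)) z :=
    hasFDerivAt_integral_of_dominated_of_fderiv_le Filter.univ_mem
      (Filter.Eventually.of_forall fun z => (hslice0 z).aestronglyMeasurable) (hslice0 z)
      (hint z).aestronglyMeasurable
      (Filter.Eventually.of_forall fun y z _ => hbound y z) hbi
      (Filter.Eventually.of_forall fun y z _ => hasFDerivAt_kernel₂ hf z y)
  have hsum : (∫ y, ∑ j, kernel₂ (preDeriv f j) z y • (coordI j : R2 N →L[ℝ] ℂ)) =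
      ∑ j, partialFourier₂ (preDeriv f j) z • coordI j :=
    integral_sum_smul_const (fun j => hslice j z) _
  rw [hsum] at key
  exact key

lemma hasFDerivAt_partialFourier₂ (f : Swo ω σ) (z : R2 N) :
    HasFDerivAt (partialFourier₂ f.1)
      (∑ j, partialFourier₂ (preDeriv f.1 j) z • coordI j) z := by
  choose S hS using exists_preDeriv_clm ω σ
  -- Taking n = 0 drops the weight and leaves an integrable majorant; it applies to `preDeriv f j`,
  -- which again belongs to the space.
  choose q _ g hg hb using fun j => (tame_swo ω σ).exists_slice_bound_snd 0
  refine hasFDerivAt_partialFourier₂_of_bound (f.2.2.1.1.differentiable (by simp))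
    ((tame_swo ω σ).integrable_slice_snd f) (fun j x => ?_)
    (g := fun j y => q j (S j f) * g j y) (fun j => (hg j).const_mul _) (fun j x y => ?_) z
  · rw [← hS]
    exact (tame_swo ω σ).integrable_slice_snd (S j f) x
  · rw [← hS]
    simpa using hb j (S j f) x y

lemma dPartial_partialFourier₂ (f : Swo ω σ) (j : Fin N ⊕ Fin N) :
    dPartial j (partialFourier₂ f.1) = partialFourier₂ (preDeriv f.1 j) :=
  funext fun z => dPartial_eq_of_hasFDerivAt (hasFDerivAt_partialFourier₂ f z) j

/-- Bootstrapping: the differential is built from partial transforms of elements of the same space,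
so the order of smoothness rises by induction over all f. -/
lemma contDiff_partialFourier₂ (f : Swo ω σ) :
    ContDiff ℝ (⊤ : ℕ∞) (partialFourier₂ f.1) := by
  choose S hS using exists_preDeriv_clm ω σ
  have hd : ∀ f : Swo ω σ, Differentiable ℝ (partialFourier₂ f.1) :=
    fun f z => (hasFDerivAt_partialFourier₂ f z).differentiableAt
  refine contDiff_infty.2 fun n => ?_
  induction n generalizing f with
  | zero => exact contDiff_zero.2 (hd f).continuous
  | succ n ih =>
    push_cast
    refine contDiff_succ_iff_fderiv.2 ⟨hd f, by simp, ?_⟩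
    have e : fderiv ℝ (partialFourier₂ f.1) =
        fun z => ∑ j, partialFourier₂ (S j f).1 z • coordI j := by
      funext z
      simp only [hS]
      exact (hasFDerivAt_partialFourier₂ f z).fderiv
    rw [e]
    exact ContDiff.sum fun j _ => (ih (S j f)).smul contDiff_const

end Derivative

/-! ### The core estimate for the second partial transform. -/

section Estimate

variable {N : ℕ} {ω σ : Fin N ⊕ Fin N → WeightFunction}

lemma fourierT_slice_partialFourier₂ (f : Swo ω σ) (y : EuclideanSpace ℝ (Fin N)) :
    fourierT (fun x => partialFourier₂ f.1 (pair x y)) =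
      fun x => fourierT f.1 (pair x y) := by
  funext x
  rw [fourierT_eq_partialFourier₁₂ f.2.1]
  rfl

/-- Fourier inversion in the first block alone, for fixed y: the transform of the slice x ↦
`partialFourier₂ f (pair x y)` is the slice of f̂. -/
lemma norm_partialFourier₂_le (f : Swo ω σ) (z : R2 N) :
    ‖partialFourier₂ f.1 z‖ ≤
      ((2 * Real.pi) ^ N)⁻¹ * ∫ x, ‖fourierT f.1 (pair x (sndBlock z))‖ := by
  set y := sndBlock z
  have hc : Continuous fun x => partialFourier₂ f.1 (pair x y) :=
    (contDiff_partialFourier₂ f).continuous.comp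
      (continuous_pair.comp (Continuous.prodMk_left y))
  have hi : Integrable fun x => partialFourier₂ f.1 (pair x y) := by
    obtain ⟨k, hk⟩ := exists_integrable_exp_neg fun j => ω (Sum.inl j)
    obtain ⟨q, -, hb⟩ := (tame_swo ω σ).exists_partialFourier₂_bound_fst k
    refine (hk.const_mul (q f)).mono' hc.aestronglyMeasurable
      (Filter.Eventually.of_forall fun x => ?_)
    have h := hb f (pair x y)
    rw [fstBlock_pair, ← zero_add ((k : ℝ) * _)] at h
    simpa using le_mul_exp_neg h
  have hi' := (tame_swo_fourier ω σ).integrable_slice_fst f y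
  rw [← fourierT_slice_partialFourier₂] at hi'
  -- The double transform reflects the argument, hence the minus sign.
  have h := fourierT_inversion hc hi hi' (-(fstBlock z))
  rw [neg_neg, pair_fstBlock_sndBlock, fourierT_slice_partialFourier₂, Fintype.card_fin] at h
  rw [le_inv_mul_iff₀ (by positivity)]
  have h' := norm_fourierT_le (fun x => fourierT f.1 (pair x y)) (-(fstBlock z))
  rw [h, norm_mul, Complex.norm_real, Real.norm_of_nonneg (by positivity)] at h'
  exact h'

lemma directSum_mixWeights (ω σ : Fin N ⊕ Fin N → WeightFunction) (z : R2 N) :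
    directSum (mixWeights ω σ) z = directSum (fun j => ω (Sum.inl j)) (fstBlock z) +
      directSum (fun j => σ (Sum.inr j)) (sndBlock z) := by
  conv_lhs => rw [← pair_fstBlock_sndBlock z, directSum_pair]
  rfl

lemma tame_partialFourier₂ (ω σ : Fin N ⊕ Fin N → WeightFunction) :
    Tame (mixWeights ω σ) (fun f : Swo ω σ => partialFourier₂ f.1) := by
  choose S hS using exists_preDeriv_clm ω σ
  refine ⟨fun f => contDiff_partialFourier₂ f, fun n l => ?_⟩
  induction l with
  | nil =>
    -- Each bound is taken with 2n because the square root of their product halves the exponents.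
    obtain ⟨p, hp, hpb⟩ := (tame_swo ω σ).exists_partialFourier₂_bound_fst (2 * n)
    obtain ⟨q, hq, hqb⟩ := (tame_swo_fourier ω σ).exists_integral_norm_bound_snd (2 * n)
    have hc : (0 : ℝ) ≤ ((2 * Real.pi) ^ N)⁻¹ := by positivity
    refine ⟨p + (Real.toNNReal ((2 * Real.pi) ^ N)⁻¹) • q,
      continuous_seminorm_add hp (continuous_nnreal_smul hq _), fun f z => ?_⟩
    have e : (p + (Real.toNNReal ((2 * Real.pi) ^ N)⁻¹) • q) f =
        p f + ((2 * Real.pi) ^ N)⁻¹ * q f := by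
      show p f + ((Real.toNNReal _ : ℝ≥0) : ℝ) * q f = _
      rw [Real.coe_toNNReal _ hc]
    rw [e, directSum_mixWeights]
    have h1 := hpb f z
    have h2 := hqb f (sndBlock z)
    set a := directSum (fun j => ω (Sum.inl j)) (fstBlock z)
    set b := directSum (fun j => σ (Sum.inr j)) (sndBlock z)
    set A := ‖partialFourier₂ f.1 z‖ with hA
    have h3 : Real.exp ((2 * n : ℕ) * b) * A ≤ ((2 * Real.pi) ^ N)⁻¹ * q f := by
      calc _ ≤ Real.exp ((2 * n : ℕ) * b) * (((2 * Real.pi) ^ N)⁻¹ *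
            ∫ x, ‖fourierT f.1 (pair x (sndBlock z))‖) := by
            gcongr
            exact norm_partialFourier₂_le f z
        _ = ((2 * Real.pi) ^ N)⁻¹ * (Real.exp ((2 * n : ℕ) * b) *
            ∫ x, ‖fourierT f.1 (pair x (sndBlock z))‖) := by ring
        _ ≤ _ := mul_le_mul_of_nonneg_left h2 hc
    have hp0 : 0 ≤ p f := apply_nonneg p f
    have hq0 : 0 ≤ ((2 * Real.pi) ^ N)⁻¹ * q f := mul_nonneg hc (apply_nonneg q f)
    refine abs_le_of_sq_le_sq' ?_ (add_nonneg hp0 hq0) |>.2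
    have h4 : (Real.exp (n * (a + b)) * A) ^ 2 =
        (Real.exp ((2 * n : ℕ) * a) * A) * (Real.exp ((2 * n : ℕ) * b) * A) := by
      have : Real.exp (n * (a + b)) ^ 2 =
          Real.exp ((2 * n : ℕ) * a) * Real.exp ((2 * n : ℕ) * b) := by
        rw [← Real.exp_add, ← Real.exp_nat_mul]
        congr 1
        push_cast
        ring
      rw [mul_pow, this]
      ring
    have h5 := mul_le_mul h1 h3 (by positivity) hp0
    show (Real.exp (n * (a + b)) * A) ^ 2 ≤ _
    rw [h4]
    -- For P, Q ≥ 0 one has PQ ≤ (P + Q)². The sum is used since, unlike the geometric mean, it is a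
    -- seminorm.
    nlinarith [mul_nonneg hp0 hq0, sq_nonneg (p f), sq_nonneg (((2 * Real.pi) ^ N)⁻¹ * q f)]
  | cons j l ih =>
    obtain ⟨q, hq, hb⟩ := ih
    refine ⟨q.comp (S j).toLinearMap, hq.comp (S j).continuous, fun f z => ?_⟩
    simp only [dWord]
    rw [dPartial_partialFourier₂, ← hS]
    exact hb (S j f) z

/-- Both sides are the second partial transform applied to the first applied to the second, by the
two orders of Fubini. -/
lemma fourierT_partialFourier₂ (f : Swo ω σ) :
    fourierT (partialFourier₂ f.1) = partialFourier₂ (fourierT f.1) := by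
  rw [fourierT_eq_partialFourier₂₁ ((tame_partialFourier₂ ω σ).integrable f),
    fourierT_eq_partialFourier₁₂ f.2.1]

lemma exists_partialFourier₂_clm (ω σ : Fin N ⊕ Fin N → WeightFunction) :
    ∃ S : Swo ω σ →L[ℂ] Swo (mixWeights ω σ) (mixWeights σ ω),
      ∀ f, (S f).1 = partialFourier₂ f.1 := by
  obtain ⟨R, hR⟩ := exists_fourier_clm ω σ
  refine exists_continuousLinearMap (T := fun f : Swo ω σ => partialFourier₂ f.1) ?_ ?_
    (tame_partialFourier₂ ω σ).integrable (tame_partialFourier₂ ω σ) ?_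
  · intro f g
    funext z
    have h := congrFun (fourierT_add ((tame_swo ω σ).integrable_slice_snd f (fstBlock z))
      ((tame_swo ω σ).integrable_slice_snd g (fstBlock z))) (sndBlock z)
    exact h
  · intro c f
    funext z
    exact congrFun (fourierT_smul c fun y => f.1 (pair (fstBlock z) y)) (sndBlock z)
  · simp only [fourierT_partialFourier₂, ← hR]
    exact (tame_partialFourier₂ σ ω).comp R

end Estimate

/-! ### Passing to the duals. -/

section Transpose

/-- Precomposition with S is continuous for both dual topologies; the hypothesis that S is the
formal transpose of T is what makes it extend T. -/
lemma exists_transpose {ι : Type} [Fintype ι] {ω σ ω' σ' : ι → WeightFunction}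
    (T : Swo ω σ →L[ℂ] Swo ω' σ') (S : Swo ω' σ' →L[ℂ] Swo ω σ)
    (h : ∀ (F : Swo ω σ) (φ : Swo ω' σ'), ∫ x, F.1 x * (S φ).1 x = ∫ x, (T F).1 x * φ.1 x) :
    ∃ T' : StrongDual ℂ (Swo ω σ) →L[ℂ] StrongDual ℂ (Swo ω' σ'),
      (∀ φ u, T' u φ = u (S φ)) ∧
      (∀ F : Swo ω σ, T' (regularDist F) = regularDist (T F)) ∧
      Continuous (fun u : WeakDual ℂ (Swo ω σ) =>
        StrongDual.toWeakDual (T' (WeakDual.toStrongDual u))) := by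
  refine ⟨ContinuousLinearMap.precomp ℂ S, fun φ u => rfl, fun F => ?_, ?_⟩
  · exact ContinuousLinearMap.ext fun φ => h F φ
  · exact WeakDual.continuous_of_continuous_eval fun φ => WeakDual.eval_continuous (S φ)

end Transpose

/-! ### Reverse direction, first block, and duality pairing. -/

section PartialFourier

variable {N : ℕ} {ω σ : Fin N ⊕ Fin N → WeightFunction}

lemma mixWeights_mixWeights (ω σ : Fin N ⊕ Fin N → WeightFunction) :
    mixWeights (mixWeights ω σ) (mixWeights σ ω) = ω := by
  funext i
  rcases i with i | i <;> rfl

lemma exists_partialFourier₂_clm_symm (ω σ : Fin N ⊕ Fin N → WeightFunction) :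
    ∃ S : Swo (mixWeights ω σ) (mixWeights σ ω) →L[ℂ] Swo ω σ,
      ∀ f, (S f).1 = partialFourier₂ f.1 := by
  have h := exists_partialFourier₂_clm (mixWeights ω σ) (mixWeights σ ω)
  rwa [mixWeights_mixWeights, mixWeights_mixWeights] at h

lemma relabel_sumComm_pair (x y : EuclideanSpace ℝ (Fin N)) :
    relabel (Equiv.sumComm (Fin N) (Fin N)) 1 (pair x y) = pair y x := by
  ext i
  rcases i with i | i <;> simp [relabel_apply, pair]

/-- Conjugation by the swap of blocks; it spares a second proof of the estimate. -/
lemma partialFourier₁_eq_relabel (F : R2 N → ℂ) (z : R2 N) :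
    partialFourier₁ F z = partialFourier₂
      (fun w => F (relabel (Equiv.sumComm (Fin N) (Fin N)) 1 w))
      (relabel (Equiv.sumComm (Fin N) (Fin N)) 1 z) := by
  rw [← pair_fstBlock_sndBlock z, relabel_sumComm_pair, partialFourier₁_apply,
    partialFourier₂_apply]
  simp only [fstBlock_pair, sndBlock_pair, relabel_sumComm_pair]

lemma exists_partialFourier₁_clm (ω σ : Fin N ⊕ Fin N → WeightFunction) :
    ∃ S : Swo ω σ →L[ℂ] Swo (mixWeights σ ω) (mixWeights ω σ),
      ∀ f, (S f).1 = partialFourier₁ f.1 := by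
  let π := Equiv.sumComm (Fin N) (Fin N)
  obtain ⟨R, hR⟩ := exists_relabel_clm ω σ π
  obtain ⟨T, hT⟩ := exists_partialFourier₂_clm (ω ∘ π) (σ ∘ π)
  obtain ⟨R', hR'⟩ := exists_relabel_clm (mixWeights (ω ∘ π) (σ ∘ π))
    (mixWeights (σ ∘ π) (ω ∘ π)) π
  have key : ∃ S : Swo ω σ →L[ℂ] Swo (mixWeights (ω ∘ π) (σ ∘ π) ∘ π)
      (mixWeights (σ ∘ π) (ω ∘ π) ∘ π), ∀ f, (S f).1 = partialFourier₁ f.1 := by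
    refine ⟨R'.comp (T.comp R), fun f => funext fun z => ?_⟩
    rw [partialFourier₁_eq_relabel, ContinuousLinearMap.comp_apply,
      ContinuousLinearMap.comp_apply, hR', hT, hR]
  -- Swapping before and after mixing exchanges which family supplies the first block.
  have e : ∀ ω σ : Fin N ⊕ Fin N → WeightFunction,
      mixWeights (ω ∘ π) (σ ∘ π) ∘ π = mixWeights σ ω := by
    intro ω σ
    funext i
    rcases i with i | i <;> rfl
  rwa [e, e] at key

lemma exists_partialFourier₁_clm_symm (ω σ : Fin N ⊕ Fin N → WeightFunction) :
    ∃ S : Swo (mixWeights σ ω) (mixWeights ω σ) →L[ℂ] Swo ω σ,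
      ∀ f, (S f).1 = partialFourier₁ f.1 := by
  have h := exists_partialFourier₁_clm (mixWeights σ ω) (mixWeights ω σ)
  rwa [mixWeights_mixWeights, mixWeights_mixWeights] at h

/-- The multiplication formula on each slice with x fixed, then integration over x. -/
lemma integral_mul_partialFourier₂ {ω' σ' : Fin N ⊕ Fin N → WeightFunction}
    (f : Swo ω σ) (g : Swo ω' σ')
    (h : Integrable fun z => f.1 z * partialFourier₂ g.1 z)
    (h' : Integrable fun z => partialFourier₂ f.1 z * g.1 z) :
    ∫ z, f.1 z * partialFourier₂ g.1 z = ∫ z, partialFourier₂ f.1 z * g.1 z := by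
  rw [integral_R2_eq h, integral_R2_eq h']
  congr 1
  funext x
  exact integral_mul_fourierT ((tame_swo ω σ).integrable_slice_snd f x)
    ((tame_swo ω' σ').integrable_slice_snd g x)

lemma integral_mul_partialFourier₁ {ω' σ' : Fin N ⊕ Fin N → WeightFunction}
    (f : Swo ω σ) (g : Swo ω' σ')
    (h : Integrable fun z => f.1 z * partialFourier₁ g.1 z)
    (h' : Integrable fun z => partialFourier₁ f.1 z * g.1 z) :
    ∫ z, f.1 z * partialFourier₁ g.1 z = ∫ z, partialFourier₁ f.1 z * g.1 z := by
  rw [integral_R2_eq_symm h, integral_R2_eq_symm h']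
  congr 1
  funext y
  exact integral_mul_fourierT ((tame_swo ω σ).integrable_slice_fst f y)
    ((tame_swo ω' σ').integrable_slice_fst g y)

end PartialFourier

end UltraDiff

open UltraDiff
theorem mainTheorem7 (N : ℕ) (ω σ : Fin N ⊕ Fin N → WeightFunction) :
    (∃ T : Swo ω σ →L[ℂ] Swo (mixWeights ω σ) (mixWeights σ ω),
      (∀ F : Swo ω σ, ∀ z : R2 N, T F z = partialFourier₂ F z) ∧
      ∃ T' : StrongDual ℂ (Swo ω σ) →L[ℂ] StrongDual ℂ (Swo (mixWeights ω σ) (mixWeights σ ω)),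
        (∀ φ : Swo (mixWeights ω σ) (mixWeights σ ω), ∃ ψ : Swo ω σ,
          (∀ z : R2 N, ψ z = partialFourier₂ φ z) ∧
          ∀ u : StrongDual ℂ (Swo ω σ), T' u φ = u ψ) ∧
        (∀ F : Swo ω σ, T' (regularDist F) = regularDist (T F)) ∧
        Continuous (fun u : WeakDual ℂ (Swo ω σ) =>
          StrongDual.toWeakDual (T' (WeakDual.toStrongDual u)))) ∧
    (∃ T : Swo ω σ →L[ℂ] Swo (mixWeights σ ω) (mixWeights ω σ),
      (∀ F : Swo ω σ, ∀ z : R2 N, T F z = partialFourier₁ F z) ∧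
      ∃ T' : StrongDual ℂ (Swo ω σ) →L[ℂ] StrongDual ℂ (Swo (mixWeights σ ω) (mixWeights ω σ)),
        (∀ φ : Swo (mixWeights σ ω) (mixWeights ω σ), ∃ ψ : Swo ω σ,
          (∀ z : R2 N, ψ z = partialFourier₁ φ z) ∧
          ∀ u : StrongDual ℂ (Swo ω σ), T' u φ = u ψ) ∧
        (∀ F : Swo ω σ, T' (regularDist F) = regularDist (T F)) ∧
        Continuous (fun u : WeakDual ℂ (Swo ω σ) =>
          StrongDual.toWeakDual (T' (WeakDual.toStrongDual u)))) := by
  constructor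
  · obtain ⟨T, hT⟩ := exists_partialFourier₂_clm ω σ
    obtain ⟨S, hS⟩ := exists_partialFourier₂_clm_symm ω σ
    -- Both products are integrable because S φ lies in the space of F and T F in that of φ.
    obtain ⟨T', h₁, h₂, h₃⟩ := exists_transpose T S fun F φ => by
      have i₁ := swo_mul_integrable F (S φ)
      have i₂ := swo_mul_integrable (T F) φ
      rw [hS] at i₁ ⊢
      rw [hT] at i₂ ⊢
      exact integral_mul_partialFourier₂ F φ i₁ i₂
    exact ⟨T, fun F z => congrFun (hT F) z, T',
      fun φ => ⟨S φ, fun z => congrFun (hS φ) z, fun u => h₁ φ u⟩, h₂, h₃⟩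
  · obtain ⟨T, hT⟩ := exists_partialFourier₁_clm ω σ
    obtain ⟨S, hS⟩ := exists_partialFourier₁_clm_symm ω σ
    obtain ⟨T', h₁, h₂, h₃⟩ := exists_transpose T S fun F φ => by
      have i₁ := swo_mul_integrable F (S φ)
      have i₂ := swo_mul_integrable (T F) φ
      rw [hS] at i₁ ⊢
      rw [hT] at i₂ ⊢
      exact integral_mul_partialFourier₁ F φ i₁ i₂
    exact ⟨T, fun F z => congrFun (hT F) z, T',
      fun φ => ⟨S φ, fun z => congrFun (hS φ) z, fun u => h₁ φ u⟩, h₂, h₃⟩
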